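/- Let $m\ge 1$ and $N\ge 1$ be coprime integers, $G=\mathrm{SL}(m,\mathbb R)$, $\mathfrak g=\mathfrak{sl}(m,\mathbb R)$, and let $H\subset G$ be the stabilizer of the line $\mathbb R\mathbf e_1$. All sequences are $N$-periodic in $n$, $\mathbf a=(a_n^r)$ with $n\in\mathbb Z/N$, $1\le r\le m-1$. The group $H^N$ acts on $G^N$ by gauge transformations $(h\cdot g)_n=h_{n+1}g_nh_n^{-1}$. The moduli space of arc-length parametrized twisted $N$-gons in centro-affine $\mathbb R^m$ is coordinatized by the geometric invariants $\mathbf a\in\mathbb R^{N(m-1)}$, defined by $\gamma_{n+m}=a_n^{m-1}\gamma_{n+m-1}+\dots+a_n^1\gamma_{n+1}+(-1)^{m-1}\gamma_n$; it is identified with the part of $G^N/H^N$ formed by the orbits that meet the section $$\mathbf a\mapsto L(\mathbf a)=\{L_n\},\qquad L_n=\begin{pmatrix}(-1)^m\mathbf a_n& I_{m-1}\\(-1)^{m-1}&0\end{pmatrix}.$$ For $\mathcal F:G^N\to\mathbb R$ let $\nabla\mathcal F(L),\nabla'\mathcal F(L)\in\mathfrak g^N$ be the left and right gradients: $\frac{d}{d\epsilon}\big|_{0}\mathcal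 F(\exp(\epsilon\xi)L)=\sum_n\mathrm{tr}(\nabla_n\mathcal F\,\xi_n)$ and $\frac{d}{d\epsilon}\big|_{0}\mathcal F(L\exp(\epsilon\xi))=\sum_n\mathrm{tr}(\nabla'_n\mathcal F\,\xi_n)$ for all $\xi\in\mathfrak g^N$. Let $\xi_\pm$ be the strictly upper/lower triangular parts of $\xi\in\mathfrak g$, let $\xi_1$ (resp. $\xi_{-1}$) be its first row (resp. first column) without the $(1,1)$ entry, and put $r(\xi\wedge\eta)=\tfrac12\mathrm{tr}(\xi(\eta_+-\eta_-))$, $r(\xi\otimes\eta)=\mathrm{tr}(\xi_-\eta_+)$. The twisted Semenov-Tian-Shansky bracket and the companion tensor on $G^N$ are $$\{\mathcal F,\mathcal H\}=\sum_{n}\Big(r(\nabla_n\mathcal F\wedge\nabla_n\mathcal H)+r(\nabla'_n\mathcal F\wedge\nabla'_n\mathcal H)-r(\nabla'_{n+1}\mathcal F\otimes\nabla_n\mathcal H)+r(\nabla'_{n+1}\mathcal H\otimes\nabla_n\mathcal F)\Big),$$ $$\theta(\mathcal F,\mathcal H)=\tfrac12\sum_n\Big(\mathrm{tr}\big((\nabla'_n\mathcal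 F)_{-1}(\nabla'_n\mathcal H)_1\big)-\mathrm{tr}\big((\nabla'_n\mathcal H)_{-1}(\nabla'_n\mathcal F)_1\big)\Big).$$ The union of the gauge orbits of the points $L(\mathbf a)$ is open in $G^N$, and every smooth function $f$ of $\mathbf a$ has a unique gauge-invariant extension $\mathcal F$ to it, with $\mathcal F(L(\mathbf a))=f(\mathbf a)$, and $\mathcal F$ is smooth. For smooth $f,g$ with invariant extensions $\mathcal F,\mathcal G$ define the reduced brackets $$\{f,g\}_R(\mathbf a)=\{\mathcal F,\mathcal G\}(L(\mathbf a)),\qquad \{f,g\}_0(\mathbf a)=\theta(\mathcal F,\mathcal G)(L(\mathbf a)).$$ Then $\{f,g\}=\{f,g\}_R+\{f,g\}_0$ is a Poisson bracket on the smooth functions on the moduli space (it is bilinear and skew-symmetric, takes smooth functions to smooth functions, and satisfies the Leibniz rule and the Jacobi identity). Therefore the reduced Poisson brackets $\{\cdot,\cdot\}_R$ and $\{\cdot,\cdot\}_0$ are compatible: both are Poisson brackets and so is every linear combination $s\{\cdot,\cdot\}_R+t\{\cdot,\cdot\}_0$ with $s,t\in\mathbb R$, so they form a bi-Hamiltonian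 structure in every dimension $m$. -/

import Mathlib

open scoped BigOperators ContDiff Topology

noncomputable section

namespace TwistedPolygon

/-! Throughout, `m = d + 1` is the dimension of the centro-affine space `ℝ^m` and `N` the period.
Periodic sequences of period `N` are indexed by `ZMod N`, so that `n ↦ n + 1` is the shift. -/

/-! ### The exponential map `sl(m, ℝ) → SL(m, ℝ)` -/

section Exponential

open scoped Matrix.Norms.Operator

theorem differentiable_det (k : ℕ) :
    Differentiable ℝ (fun M : Matrix (Fin k) (Fin k) ℝ => M.det) := by
  have hentry : ∀ i j : Fin k, Differentiable ℝ (fun M : Matrix (Fin k) (Fin k) ℝ => M i j) :=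
    fun i j => (LinearMap.toContinuousLinearMap
      (Matrix.entryLinearMap ℝ ℝ i j : Matrix (Fin k) (Fin k) ℝ →ₗ[ℝ] ℝ)).differentiable
  simp only [Matrix.det_apply]
  refine Differentiable.fun_sum fun σ _ => Differentiable.const_smul ?_ _
  intro M
  exact (HasFDerivAt.finsetProd (u := Finset.univ)
    (g := fun i (M : Matrix (Fin k) (Fin k) ℝ) => M (σ i) i)
    fun i _ => (hentry (σ i) i M).hasFDerivAt).differentiableAt

theorem fderiv_det_one (k : ℕ) (A : Matrix (Fin k) (Fin k) ℝ) :
    fderiv ℝ (fun M : Matrix (Fin k) (Fin k) ℝ => M.det) 1 A = A.trace := by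
  have h1 : HasDerivAt (fun r : ℝ => (1 : Matrix (Fin k) (Fin k) ℝ) + r • A) A 0 := by
    have h := ((hasDerivAt_id (0 : ℝ)).smul_const A).const_add (1 : Matrix (Fin k) (Fin k) ℝ)
    rw [one_smul] at h
    exact h
  have h0 : (1 : Matrix (Fin k) (Fin k) ℝ) + (0 : ℝ) • A = 1 := by simp
  have h2 := (h0.symm ▸ (differentiable_det k 1).hasFDerivAt :
    HasFDerivAt (fun M : Matrix (Fin k) (Fin k) ℝ => M.det)
      (fderiv ℝ (fun M : Matrix (Fin k) (Fin k) ℝ => M.det) 1)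
      ((1 : Matrix (Fin k) (Fin k) ℝ) + (0 : ℝ) • A)).comp_hasDerivAt (0 : ℝ) h1
  obtain ⟨q, hq⟩ : ∃ q : Polynomial ℝ, ∀ r : ℝ,
      (1 + r • A).det = 1 + A.trace * r + q.eval r * r ^ 2 :=
    ⟨_, fun r => Matrix.det_one_add_smul r A⟩
  have h3 : HasDerivAt (fun r : ℝ => 1 + A.trace * r + q.eval r * r ^ 2) A.trace 0 := by
    have := (((hasDerivAt_id (0 : ℝ)).const_mul A.trace).const_add 1).add
      ((q.hasDerivAt 0).mul (hasDerivAt_pow 2 (0 : ℝ)))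
    exact this.congr_deriv (by simp)
  refine h2.unique ?_
  exact h3.congr_of_eventuallyEq (Filter.Eventually.of_forall hq)

theorem det_exp_of_trace_eq_zero (k : ℕ) (A : Matrix (Fin k) (Fin k) ℝ) (hA : A.trace = 0) :
    (NormedSpace.exp A).det = 1 := by
  have hder : ∀ t : ℝ, HasDerivAt (fun u : ℝ => (NormedSpace.exp (u • A)).det) 0 t := by
    intro t
    have hs : HasDerivAt (fun u : ℝ => NormedSpace.exp ((u - t) • A)) A t := by
      have h := hasDerivAt_exp_smul_const (𝕂 := ℝ) A (t - t)
      have h' := HasDerivAt.scomp (h := fun u : ℝ => u - t) t h ((hasDerivAt_id t).sub_const t)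
      exact h'.congr_deriv (by simp)
    have he : NormedSpace.exp ((t - t) • A) = (1 : Matrix (Fin k) (Fin k) ℝ) := by simp
    have h2 := (he.symm ▸ (differentiable_det k 1).hasFDerivAt :
      HasFDerivAt (fun M : Matrix (Fin k) (Fin k) ℝ => M.det)
        (fderiv ℝ (fun M : Matrix (Fin k) (Fin k) ℝ => M.det) 1)
        (NormedSpace.exp ((t - t) • A))).comp_hasDerivAt t hs
    have h3 := (h2.congr_deriv ((fderiv_det_one k A).trans hA)).const_mul (NormedSpace.exp (t • A)).det
    rw [mul_zero] at h3
    refine h3.congr_of_eventuallyEq (Filter.Eventually.of_forall fun u => ?_)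
    have hc : Commute (t • A) ((u - t) • A) :=
      ((Commute.refl A).smul_left t).smul_right (u - t)
    have hsum : u • A = t • A + (u - t) • A := by rw [← add_smul]; congr 1; ring
    simp only [Function.comp_apply]
    rw [hsum, Matrix.exp_add_of_commute _ _ hc, Matrix.det_mul]
  have hconst := is_const_of_deriv_eq_zero (fun t => (hder t).differentiableAt)
    (fun t => (hder t).deriv) 1 0
  simpa using hconst

end Exponential

/-- The Lie algebra `sl(m, ℝ)`, `m = d + 1`. -/
abbrev Alg (d : ℕ) : Type := LieAlgebra.SpecialLinear.sl (Fin (d + 1)) ℝ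

/-- The group `G = SL(m, ℝ)`, `m = d + 1`. -/
abbrev Grp (d : ℕ) : Type := Matrix.SpecialLinearGroup (Fin (d + 1)) ℝ

/-- The exponential map `sl(m, ℝ) → SL(m, ℝ)`. -/
def expSL {d : ℕ} (ξ : Alg d) : Grp d :=
  ⟨NormedSpace.exp (ξ : Matrix (Fin (d + 1)) (Fin (d + 1)) ℝ),
    det_exp_of_trace_eq_zero (d + 1) _ (LinearMap.mem_ker.1 ξ.2)⟩

/-! ### Smooth functions on `G^N` and their gradients -/

/-- The matrix entries of an element of `G^N`. -/
def entries {d N : ℕ} (L : ZMod N → Grp d) : ZMod N → Fin (d + 1) → Fin (d + 1) → ℝ :=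
  fun n i j => (L n : Matrix (Fin (d + 1)) (Fin (d + 1)) ℝ) i j

/-- `F : G^N → ℝ` is smooth at `L`: near `L` it is the restriction to the embedded submanifold
`G^N` of a smooth function of the matrix entries. -/
def SmoothAt {d N : ℕ} [NeZero N] (F : (ZMod N → Grp d) → ℝ) (L : ZMod N → Grp d) : Prop :=
  ∃ Φ : (ZMod N → Fin (d + 1) → Fin (d + 1) → ℝ) → ℝ,
    ContDiffAt ℝ ∞ Φ (entries L) ∧ ∀ᶠ L' in 𝓝 L, F L' = Φ (entries L')

/-- The inner product `⟨ξ, η⟩ = ∑ₙ tr (ξₙ ηₙ)` on `sl(m, ℝ)^N`. -/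
def pairing {d N : ℕ} [NeZero N] (ξ η : ZMod N → Alg d) : ℝ :=
  ∑ n, ((ξ n : Matrix (Fin (d + 1)) (Fin (d + 1)) ℝ) * (η n).1).trace

/-- `X` is the left gradient of `F` at `L`:
`d/dε F (exp (ε ξ) L) = ⟨X, ξ⟩` at `ε = 0`, for all `ξ`. -/
def IsLeftGradient {d N : ℕ} [NeZero N] (F : (ZMod N → Grp d) → ℝ) (L : ZMod N → Grp d)
    (X : ZMod N → Alg d) : Prop :=
  ∀ ξ : ZMod N → Alg d,
    HasDerivAt (fun ε : ℝ => F (fun n => expSL (ε • ξ n) * L n)) (pairing X ξ) 0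

/-- `X` is the right gradient of `F` at `L`:
`d/dε F (L exp (ε ξ)) = ⟨X, ξ⟩` at `ε = 0`, for all `ξ`. -/
def IsRightGradient {d N : ℕ} [NeZero N] (F : (ZMod N → Grp d) → ℝ) (L : ZMod N → Grp d)
    (X : ZMod N → Alg d) : Prop :=
  ∀ ξ : ZMod N → Alg d,
    HasDerivAt (fun ε : ℝ => F (fun n => L n * expSL (ε • ξ n))) (pairing X ξ) 0

open Classical in
/-- The left gradient `∇F(L)` (zero if it does not exist). -/
def leftGradient {d N : ℕ} [NeZero N] (F : (ZMod N → Grp d) → ℝ) (L : ZMod N → Grp d) :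
    ZMod N → Alg d :=
  if h : ∃ X, IsLeftGradient F L X then h.choose else 0

open Classical in
/-- The right gradient `∇'F(L)` (zero if it does not exist). -/
def rightGradient {d N : ℕ} [NeZero N] (F : (ZMod N → Grp d) → ℝ) (L : ZMod N → Grp d) :
    ZMod N → Alg d :=
  if h : ∃ X, IsRightGradient F L X then h.choose else 0

/-! ### The two gradations -/

/-- Component in `𝔤₊`, the strictly upper triangular matrices. -/
def upper {d : ℕ} (X : Alg d) : Matrix (Fin (d + 1)) (Fin (d + 1)) ℝ :=
  Matrix.of fun i j => if i < j then X.1 i j else 0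

/-- Component in `𝔤₋`, the strictly lower triangular matrices. -/
def lower {d : ℕ} (X : Alg d) : Matrix (Fin (d + 1)) (Fin (d + 1)) ℝ :=
  Matrix.of fun i j => if j < i then X.1 i j else 0

/-- Component in `𝔤₁`: first row without its first entry. -/
def gradeOne {d : ℕ} (X : Alg d) : Matrix (Fin (d + 1)) (Fin (d + 1)) ℝ :=
  Matrix.of fun i j => if i = 0 ∧ j ≠ 0 then X.1 i j else 0

/-- Component in `𝔤₋₁`: first column without its first entry. -/
def gradeNegOne {d : ℕ} (X : Alg d) : Matrix (Fin (d + 1)) (Fin (d + 1)) ℝ :=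
  Matrix.of fun i j => if i ≠ 0 ∧ j = 0 then X.1 i j else 0

/-- The classical `R`-matrix `R(ξ) = (ξ₊ - ξ₋) / 2`. -/
def rMatrix {d : ℕ} (ξ : Alg d) : Matrix (Fin (d + 1)) (Fin (d + 1)) ℝ :=
  (1 / 2 : ℝ) • (upper ξ - lower ξ)

/-- `r(ξ ∧ η) = ⟨ξ, R(η)⟩`. -/
def rWedge {d : ℕ} (ξ η : Alg d) : ℝ := (ξ.1 * rMatrix η).trace

/-- `r(ξ ⊗ η) = ⟨ξ₋, η₊⟩`. -/
def rTensor {d : ℕ} (ξ η : Alg d) : ℝ := (lower ξ * upper η).trace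

/-! ### The two tensors on `G^N` -/

/-- The twisted Semenov-Tian-Shansky Poisson bracket on `G^N`. -/
def twistedBracket {d N : ℕ} [NeZero N] (F K : (ZMod N → Grp d) → ℝ) (L : ZMod N → Grp d) : ℝ :=
  ∑ s, rWedge (leftGradient F L s) (leftGradient K L s)
    + ∑ s, rWedge (rightGradient F L s) (rightGradient K L s)
    - ∑ s, rTensor (rightGradient F L (s + 1)) (leftGradient K L s)
    + ∑ s, rTensor (rightGradient K L (s + 1)) (leftGradient F L s)

/-- The companion tensor `θ` on `G^N` (not itself a Poisson tensor). -/
def companionTensor {d N : ℕ} [NeZero N] (F K : (ZMod N → Grp d) → ℝ) (L : ZMod N → Grp d) : ℝ :=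
  (1 / 2 : ℝ) * ∑ n,
    ((gradeNegOne (rightGradient F L n) * gradeOne (rightGradient K L n)).trace
      - (gradeNegOne (rightGradient K L n) * gradeOne (rightGradient F L n)).trace)

/-! ### The moduli space `G^N / H^N` -/

/-- The subgroup `H ⊆ SL(m, ℝ)` with Lie algebra `𝔤₀ ⊕ 𝔤₁`: the stabilizer of the line
spanned by the first basis vector. -/
def parabolic (d : ℕ) : Subgroup (Grp d) where
  carrier := {h | ∀ i : Fin (d + 1), i ≠ 0 → h.1 i 0 = 0}
  one_mem' := fun i hi => by simp [hi]
  mul_mem' := by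
    intro a b ha hb i hi
    rw [Matrix.SpecialLinearGroup.coe_mul, Matrix.mul_apply]
    refine Finset.sum_eq_zero fun j _ => ?_
    by_cases hj : j = 0
    · rw [hj, ha i hi, zero_mul]
    · rw [hb j hj, mul_zero]
  inv_mem' := by
    intro a ha i hi
    have hcol : ∀ k : Fin (d + 1), (a⁻¹ * a).1 k 0 = a⁻¹.1 k 0 * a.1 0 0 := by
      intro k
      rw [Matrix.SpecialLinearGroup.coe_mul, Matrix.mul_apply]
      refine Finset.sum_eq_single_of_mem 0 (Finset.mem_univ _) fun j _ hj => ?_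
      rw [ha j hj, mul_zero]
    have h0 := hcol 0
    have h1 := hcol i
    rw [inv_mul_cancel, Matrix.SpecialLinearGroup.coe_one] at h0 h1
    rw [Matrix.one_apply_eq] at h0
    rw [Matrix.one_apply_ne hi] at h1
    rcases mul_eq_zero.1 h1.symm with h | h
    · exact h
    · rw [h, mul_zero] at h0
      exact absurd h0 one_ne_zero

/-- The discrete gauge action of `H^N` on `G^N`: `(h, g) ↦ h_{n+1} g_n h_n⁻¹`. -/
def gauge {d N : ℕ} (h : ZMod N → parabolic d) (g : ZMod N → Grp d) : ZMod N → Grp d :=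
  fun n => (h (n + 1) : Grp d) * g n * (h n : Grp d)⁻¹

/-- The coordinate space of the moduli space: the geometric invariants `a_n^r`,
`1 ≤ r ≤ m - 1`, of an arc-length parametrized twisted `N`-gon in `ℝ^m`, given by
`γ_{n+m} = a_n^{m-1} γ_{n+m-1} + ⋯ + a_n^1 γ_{n+1} + (-1)^{m-1} γ_n`
(`a_n^r` is `a n (r - 1)` here). -/
abbrev Invariants (d N : ℕ) : Type := ZMod N → Fin d → ℝ

/-- The inverse Maurer-Cartan matrix with invariants `a`:
the first column is `((-1)^m a, (-1)^{m-1})`, the upper right block is the identity, and the rest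
of the last row vanishes. -/
def frameMatrix {d : ℕ} (a : Fin d → ℝ) : Matrix (Fin (d + 1)) (Fin (d + 1)) ℝ :=
  Matrix.of fun i =>
    (Fin.cons (Fin.snoc (α := fun _ => ℝ) (fun r => (-1) ^ (d + 1) * a r) ((-1) ^ d) i)
      (fun r : Fin d => if i = r.castSucc then 1 else 0) : Fin (d + 1) → ℝ)

theorem det_frameMatrix {d : ℕ} (a : Fin d → ℝ) : (frameMatrix a).det = 1 := by
  rw [Matrix.det_succ_row _ (Fin.last d), Fin.sum_univ_succ]
  have hsub : (frameMatrix a).submatrix (Fin.last d).succAbove (Fin.succAbove 0) = 1 := by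
    ext i j
    simp [frameMatrix, Matrix.one_apply]
  have hz : ∀ r : Fin d, frameMatrix a (Fin.last d) r.succ = 0 := by
    intro r
    simp [frameMatrix, (Fin.castSucc_lt_last r).ne']
  have h0 : frameMatrix a (Fin.last d) 0 = (-1) ^ d := by
    simp [frameMatrix]
  rw [hsub, h0]
  simp [hz, ← mul_pow]

/-- The section `a ↦ L(a)` of `G^N → G^N / H^N` by inverse Maurer-Cartan matrices. -/
def frameSection {d N : ℕ} (a : Invariants d N) : ZMod N → Grp d :=
  fun n => ⟨frameMatrix (a n), det_frameMatrix (a n)⟩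

/-- The union of the gauge orbits that meet the section, i.e. the part of `G^N` that lies over the
moduli space of arc-length parametrized twisted polygons. -/
def regularSet (d N : ℕ) : Set (ZMod N → Grp d) :=
  {L | ∃ (a : Invariants d N) (h : ZMod N → parabolic d), gauge h (frameSection a) = L}

open Classical in
/-- The extension of a function `f` of the invariants to `G^N` that is constant on gauge orbits
(by convention `0` off the orbits that meet the section). -/
def invariantExtension {d N : ℕ} (f : Invariants d N → ℝ) : (ZMod N → Grp d) → ℝ :=
  fun L =>
    if hL : ∃ (a : Invariants d N) (h : ZMod N → parabolic d), gauge h (frameSection a) = L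
    then f hL.choose else 0

/-- `F` is a gauge-invariant extension of `f`, smooth over the moduli space. -/
structure IsInvariantExtension {d N : ℕ} [NeZero N] (f : Invariants d N → ℝ)
    (F : (ZMod N → Grp d) → ℝ) : Prop where
  invariant : ∀ (h : ZMod N → parabolic d) (L : ZMod N → Grp d), F (gauge h L) = F L
  extends_fun : ∀ a : Invariants d N, F (frameSection a) = f a
  smooth : ∀ L ∈ regularSet d N, SmoothAt F L

/-- The reduced twisted bracket `{f, g}_R (a) = {F, G}(L(a))`. -/
def reducedBracket {d N : ℕ} [NeZero N] (f g : Invariants d N → ℝ) : Invariants d N → ℝ :=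
  fun a => twistedBracket (invariantExtension f) (invariantExtension g) (frameSection a)

/-- The reduced companion bracket `{f, g}_0 (a) = θ(F, G)(L(a))`. -/
def companionBracket {d N : ℕ} [NeZero N] (f g : Invariants d N → ℝ) : Invariants d N → ℝ :=
  fun a => companionTensor (invariantExtension f) (invariantExtension g) (frameSection a)

/-! ### Poisson brackets -/

/-- `B` is a Poisson bracket on the algebra of smooth functions on `E`. -/
structure IsPoissonBracket {E : Type*} [NormedAddCommGroup E] [NormedSpace ℝ E]
    (B : (E → ℝ) → (E → ℝ) → (E → ℝ)) : Prop where
  smooth : ∀ f g : E → ℝ, ContDiff ℝ ∞ f → ContDiff ℝ ∞ g → ContDiff ℝ ∞ (B f g)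
  add_left : ∀ f g h : E → ℝ, ContDiff ℝ ∞ f → ContDiff ℝ ∞ g → ContDiff ℝ ∞ h →
    B (f + g) h = B f h + B g h
  smul_left : ∀ (c : ℝ) (f g : E → ℝ), ContDiff ℝ ∞ f → ContDiff ℝ ∞ g →
    B (c • f) g = c • B f g
  skew : ∀ f g : E → ℝ, ContDiff ℝ ∞ f → ContDiff ℝ ∞ g → B f g = -B g f
  leibniz : ∀ f g h : E → ℝ, ContDiff ℝ ∞ f → ContDiff ℝ ∞ g → ContDiff ℝ ∞ h →
    B (f * g) h = f * B g h + g * B f h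
  jacobi : ∀ f g h : E → ℝ, ContDiff ℝ ∞ f → ContDiff ℝ ∞ g → ContDiff ℝ ∞ h →
    B (B f g) h + B (B g h) f + B (B h f) g = 0

/-- Two Poisson brackets are compatible (form a bi-Hamiltonian structure): each of them is a
Poisson bracket and so is every linear combination of them. -/
def AreCompatible {E : Type*} [NormedAddCommGroup E] [NormedSpace ℝ E]
    (B₁ B₂ : (E → ℝ) → (E → ℝ) → (E → ℝ)) : Prop :=
  IsPoissonBracket B₁ ∧ IsPoissonBracket B₂ ∧
    ∀ s t : ℝ, IsPoissonBracket fun f g => s • B₁ f g + t • B₂ f g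

end TwistedPolygon

end

/-! Encode the invariants `a` as the scalar difference operator `Tᵐ - ∑ᵣ aʳ Tʳ + e`, where `T` is
the shift. Difference operators of period `N` form an associative algebra with a trace, on whose
double the pairs of operators of nonnegative degree and those of nonpositive degree are
complementary isotropic subalgebras, up to a twist by `Tᵐ` in degree zero. Projecting the gradient
pair `(D Ξ, Ξ D)` along this splitting gives a quadratic Poisson bracket; solving `y - Tᵐ y = x`
for the degree zero part is where `m` and `N` have to be coprime. The bracket restricts to the
operators above for every constant `e` and is affine in `e` there, so it is a pencil of Poisson
brackets.

A vector sequence is acted on by difference operators through `(T w)ₙ = Lₙ⁻¹ wₙ₊₁`. For `L = L(a)`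
the constant sequence `e₁` is cyclic and annihilated by the operator of `a` with `e = (-1)ᵐ`.
Through this action the gradients at `L(a)` of the invariant extension of `f` become the
projections of the gradient pairs of `df`. Hence the twisted bracket reduces to the member
`e = (-1)ᵐ` of the pencil and the companion bracket to a multiple of its coefficient of `e`.

The invariant extensions are smooth because the gauge to the section is: its diagonal entries are
found from the products of `m` consecutive ones, again because `m` and `N` are coprime. -/

noncomputable section

namespace TwistedPolygon

/-! ### Poisson tensors -/

section PoissonTensors

variable {E : Type*} [NormedAddCommGroup E] [NormedSpace ℝ E]

theorem IsPoissonBracket.congr {B B' : (E → ℝ) → (E → ℝ) → E → ℝ} (hB' : IsPoissonBracket B')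
    (h : ∀ f g, ContDiff ℝ ∞ f → ContDiff ℝ ∞ g → B f g = B' f g) : IsPoissonBracket B where
  smooth f g hf hg := h f g hf hg ▸ hB'.smooth f g hf hg
  add_left f g k hf hg hk := by
    rw [h (f + g) k (hf.add hg) hk, h _ _ hf hk, h _ _ hg hk, hB'.add_left f g k hf hg hk]
  smul_left c f g hf hg := by
    rw [h (c • f) g (hf.const_smul c) hg, h _ _ hf hg, hB'.smul_left c f g hf hg]
  skew f g hf hg := by rw [h _ _ hf hg, h _ _ hg hf, hB'.skew f g hf hg]
  leibniz f g k hf hg hk := by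
    rw [h (f * g) k (hf.mul hg) hk, h _ _ hf hk, h _ _ hg hk, hB'.leibniz f g k hf hg hk]
  jacobi f g k hf hg hk := by
    rw [h _ _ hf hg, h _ _ hg hk, h _ _ hk hf, h _ _ (hB'.smooth f g hf hg) hk,
      h _ _ (hB'.smooth g k hg hk) hf, h _ _ (hB'.smooth k f hk hf) hg, hB'.jacobi f g k hf hg hk]

/-- The bracket `{f, g} = df (V dg)` of a bivector field, encoded as a field `V` of operators from
covectors to vectors. -/
def tensorBracket (V : E → (E →L[ℝ] ℝ) →L[ℝ] E) (f g : E → ℝ) : E → ℝ :=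
  fun x => fderiv ℝ f x (V x (fderiv ℝ g x))

/-- A Poisson tensor, encoded as a field of operators from covectors to vectors. The Jacobi identity
is imposed on constant covectors only: it then holds for all differentials, since second derivatives
are symmetric. -/
structure IsPoissonTensor (V : E → (E →L[ℝ] ℝ) →L[ℝ] E) : Prop where
  contDiff : ContDiff ℝ ∞ V
  skew : ∀ (x : E) (ξ η : E →L[ℝ] ℝ), ξ (V x η) = -η (V x ξ)
  jacobi : ∀ (x : E) (ξ η ζ : E →L[ℝ] ℝ), ξ (fderiv ℝ V x (V x ζ) η) + η (fderiv ℝ V x (V x ξ) ζ)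
    + ζ (fderiv ℝ V x (V x η) ξ) = 0

theorem contDiff_fderiv_infty {f : E → ℝ} (hf : ContDiff ℝ ∞ f) : ContDiff ℝ ∞ (fderiv ℝ f) :=
  hf.fderiv_right (by simp)

theorem contDiff_tensorBracket {V : E → (E →L[ℝ] ℝ) →L[ℝ] E} (hV : ContDiff ℝ ∞ V) {f g : E → ℝ}
    (hf : ContDiff ℝ ∞ f) (hg : ContDiff ℝ ∞ g) : ContDiff ℝ ∞ (tensorBracket V f g) :=
  (contDiff_fderiv_infty hf).clm_apply (hV.clm_apply (contDiff_fderiv_infty hg))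

theorem fderiv_tensorBracket {V : E → (E →L[ℝ] ℝ) →L[ℝ] E} (hV : ContDiff ℝ ∞ V) {f g : E → ℝ}
    (hf : ContDiff ℝ ∞ f) (hg : ContDiff ℝ ∞ g) (x v : E) :
    fderiv ℝ (tensorBracket V f g) x v =
      fderiv ℝ (fderiv ℝ f) x v (V x (fderiv ℝ g x))
        + fderiv ℝ f x (fderiv ℝ V x v (fderiv ℝ g x))
        + fderiv ℝ f x (V x (fderiv ℝ (fderiv ℝ g) x v)) := by
  have hf' := ((contDiff_fderiv_infty hf).differentiable (by simp) x).hasFDerivAt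
  have hg' := ((contDiff_fderiv_infty hg).differentiable (by simp) x).hasFDerivAt
  have hV' := (hV.differentiable (by simp) x).hasFDerivAt
  have h : HasFDerivAt (tensorBracket V f g) _ x := hf'.clm_apply (hV'.clm_apply hg')
  rw [h.fderiv]
  simp only [ContinuousLinearMap.comp_add, add_apply, ContinuousLinearMap.comp_apply,
    ContinuousLinearMap.flip_apply]
  ring

theorem fderiv_fderiv_comm {f : E → ℝ} (hf : ContDiff ℝ ∞ f) (x v w : E) :
    fderiv ℝ (fderiv ℝ f) x v w = fderiv ℝ (fderiv ℝ f) x w v :=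
  (hf.contDiffAt.isSymmSndFDerivAt
    (by simpa using WithTop.coe_le_coe.2 (le_top : (2 : ℕ∞) ≤ ⊤))).eq v w

namespace IsPoissonTensor

variable {V : E → (E →L[ℝ] ℝ) →L[ℝ] E}

theorem jacobi_tensorBracket (hV : IsPoissonTensor V) {f g h : E → ℝ} (hf : ContDiff ℝ ∞ f)
    (hg : ContDiff ℝ ∞ g) (hh : ContDiff ℝ ∞ h) :
    tensorBracket V (tensorBracket V f g) h + tensorBracket V (tensorBracket V g h) f
      + tensorBracket V (tensorBracket V h f) g = 0 := by
  funext x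
  change fderiv ℝ (tensorBracket V f g) x (V x (fderiv ℝ h x))
    + fderiv ℝ (tensorBracket V g h) x (V x (fderiv ℝ f x))
    + fderiv ℝ (tensorBracket V h f) x (V x (fderiv ℝ g x)) = 0
  have hskew := hV.skew x
  -- The second derivative of each function occurs twice; skewness and symmetry cancel the two.
  rw [fderiv_tensorBracket hV.contDiff hf hg, fderiv_tensorBracket hV.contDiff hg hh,
    fderiv_tensorBracket hV.contDiff hh hf, hskew (fderiv ℝ f x) (fderiv ℝ (fderiv ℝ g) x _),
    hskew (fderiv ℝ g x) (fderiv ℝ (fderiv ℝ h) x _),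
    hskew (fderiv ℝ h x) (fderiv ℝ (fderiv ℝ f) x _),
    fderiv_fderiv_comm hf x (V x (fderiv ℝ h x)), fderiv_fderiv_comm hg x (V x (fderiv ℝ f x)),
    fderiv_fderiv_comm hh x (V x (fderiv ℝ g x))]
  linarith [hV.jacobi x (fderiv ℝ f x) (fderiv ℝ g x) (fderiv ℝ h x)]

theorem isPoissonBracket (hV : IsPoissonTensor V) : IsPoissonBracket (tensorBracket V) where
  smooth f g := contDiff_tensorBracket hV.contDiff
  add_left f g h hf hg _ := by
    funext x
    simp [tensorBracket, fderiv_add (hf.differentiable (by simp) x)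
      (hg.differentiable (by simp) x)]
  smul_left c f g hf _ := by
    funext x
    simp [tensorBracket, fderiv_const_smul (hf.differentiable (by simp) x)]
  skew f g _ _ := funext fun x => hV.skew x _ _
  leibniz f g h hf hg _ := by
    funext x
    simp [tensorBracket, fderiv_mul (hf.differentiable (by simp) x)
      (hg.differentiable (by simp) x)]
  jacobi f g h := hV.jacobi_tensorBracket

theorem smul_add_smul {V₀ V₁ : E → (E →L[ℝ] ℝ) →L[ℝ] E}
    (hV : ∀ e : ℝ, IsPoissonTensor (V₀ + e • V₁)) (s t : ℝ) :
    IsPoissonTensor (s • V₀ + t • V₁) := by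
  have h₀ : ContDiff ℝ ∞ V₀ := by simpa using (hV 0).contDiff
  have h₁ : ContDiff ℝ ∞ V₁ := by
    convert (hV 1).contDiff.sub h₀ using 1
    rw [one_smul]
    exact (add_sub_cancel_left V₀ V₁).symm
  refine ⟨(h₀.const_smul s).add (h₁.const_smul t), fun x ξ η => ?_, fun x ξ η ζ => ?_⟩
  · have hskew₀ := (hV 0).skew x ξ η
    have hskew₁ := (hV 1).skew x ξ η
    simp only [Pi.add_apply, Pi.smul_apply, add_apply, smul_apply, map_add, map_smul,
      smul_eq_mul] at hskew₀ hskew₁ ⊢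
    linear_combination (s - t) * hskew₀ + t * hskew₁
  · have d₀ := h₀.differentiable (by simp) x
    have d₁ := h₁.differentiable (by simp) x
    have hjac₀ := (hV 0).jacobi x ξ η ζ
    have hjac₁ := (hV 1).jacobi x ξ η ζ
    have hjac₂ := (hV (-1)).jacobi x ξ η ζ
    simp only [fderiv_add d₀ (d₁.const_smul _), fderiv_add (d₀.const_smul s) (d₁.const_smul t),
      fderiv_const_smul d₀, fderiv_const_smul d₁, Pi.add_apply, Pi.smul_apply, add_apply,
      smul_apply, map_add, map_smul, smul_eq_mul] at hjac₀ hjac₁ hjac₂ ⊢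
    -- Interpolation of the quadratic form in `(s, t)` from its values at `(1, 0)`, `(1, ±1)`.
    linear_combination (s ^ 2 - t ^ 2) * hjac₀ + (s * t + t ^ 2) / 2 * hjac₁
      + (t ^ 2 - s * t) / 2 * hjac₂

end IsPoissonTensor

theorem tensorBracket_smul_add_smul (V₀ V₁ : E → (E →L[ℝ] ℝ) →L[ℝ] E) (s t : ℝ) :
    tensorBracket (s • V₀ + t • V₁) = s • tensorBracket V₀ + t • tensorBracket V₁ := by
  funext f g x
  simp [tensorBracket]

end PoissonTensors

/-! ### Quadratic brackets on associative algebras -/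

section QuadraticBracket

variable {A R : Type*} [Ring A] [CommRing R] {tr : A →+ R}

variable (tr) in
/-- The trace `(a, b) ↦ tr a - tr b` on the double `A × A` of an associative algebra. -/
def doubleTrace : A × A →+ R :=
  tr.comp (AddMonoidHom.fst A A) - tr.comp (AddMonoidHom.snd A A)

theorem doubleTrace_apply (p : A × A) : doubleTrace tr p = tr p.1 - tr p.2 := rfl

theorem doubleTrace_mul_comm (htr : ∀ x y, tr (x * y) = tr (y * x)) (p q : A × A) :
    doubleTrace tr (p * q) = doubleTrace tr (q * p) := by
  simp only [doubleTrace_apply, Prod.fst_mul, Prod.snd_mul, htr p.1, htr p.2]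

/-- The pair `(D Ξ, Ξ D)` of the left and right gradients at `D` of the function `tr (Ξ ·)`. -/
def gradientPair (D Ξ : A) : A × A := (D * Ξ, Ξ * D)

/-- The tangent vector `a D - D b` at `D` generated by the pair `p = (a, b)`. -/
def twoSidedAction (p : A × A) (D : A) : A := p.1 * D - D * p.2

theorem gradientPair_mul_gradientPair (D Ξ Ξ' : A) :
    gradientPair D Ξ * gradientPair D Ξ' = gradientPair D (Ξ * D * Ξ') :=
  Prod.ext (by simp only [gradientPair, Prod.fst_mul, mul_assoc])
    (by simp only [gradientPair, Prod.snd_mul, mul_assoc])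

theorem doubleTrace_gradientPair (htr : ∀ x y, tr (x * y) = tr (y * x)) (D Ξ : A) :
    doubleTrace tr (gradientPair D Ξ) = 0 :=
  sub_eq_zero.2 (htr D Ξ)

theorem twoSidedAction_commutator (p q : A × A) (D : A) :
    twoSidedAction p (twoSidedAction q D) - twoSidedAction q (twoSidedAction p D)
      = twoSidedAction (p * q - q * p) D := by
  simp only [twoSidedAction, Prod.fst_sub, Prod.snd_sub, Prod.fst_mul, Prod.snd_mul]
  noncomm_ring

theorem twoSidedAction_sub (p q : A × A) (D : A) :
    twoSidedAction (p - q) D = twoSidedAction p D - twoSidedAction q D := by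
  simp only [twoSidedAction, Prod.fst_sub, Prod.snd_sub]
  noncomm_ring

theorem twoSidedAction_gradientPair (D Ξ : A) : twoSidedAction (gradientPair D Ξ) D = 0 :=
  sub_eq_zero.2 (mul_assoc D Ξ D)

theorem twoSidedAction_gradientPair_twoSidedAction (D Ξ : A) (p : A × A) :
    twoSidedAction (gradientPair D Ξ) (twoSidedAction p D)
      = twoSidedAction (gradientPair D Ξ * p - p * gradientPair D Ξ) D := by
  have hzero : twoSidedAction p (0 : A) = 0 := by
    simp only [twoSidedAction, mul_zero, zero_mul, sub_zero]
  rw [← twoSidedAction_commutator, twoSidedAction_gradientPair, hzero, sub_zero]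

theorem trace_mul_twoSidedAction (htr : ∀ x y, tr (x * y) = tr (y * x)) (D Ξ : A) (p : A × A) :
    tr (Ξ * twoSidedAction p D) = doubleTrace tr (gradientPair D Ξ * p) := by
  have h : tr (Ξ * (p.1 * D)) = tr (D * Ξ * p.1) := by rw [← mul_assoc, htr, ← mul_assoc]
  simp only [doubleTrace_apply, gradientPair, twoSidedAction, Prod.fst_mul, Prod.snd_mul, mul_sub,
    map_sub, h, mul_assoc]

variable (tr) in
/-- Two multiplicatively closed subsets `S` and `T` of the double `A × A` on which its trace
vanishes: these are isotropic for the trace form, as in the Manin triples that define classical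
`r`-matrices. -/
structure IsIsotropicPair (S T : Subsemigroup (A × A)) : Prop where
  trace_comm : ∀ x y, tr (x * y) = tr (y * x)
  trace_left : ∀ p ∈ S, doubleTrace tr p = 0
  trace_right : ∀ p ∈ T, doubleTrace tr p = 0

namespace IsIsotropicPair

variable {S T : Subsemigroup (A × A)}

theorem doubleTrace_mul_of_sub_mem (h : IsIsotropicPair tr S T) {g p γ c : A × A} (hp : p ∈ S)
    (hg : g - p ∈ T) (hc : c ∈ S) (hγ : γ - c ∈ T) :
    doubleTrace tr (g * c) = doubleTrace tr (g * γ) - doubleTrace tr (p * γ) := by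
  have hT := h.trace_right _ (T.mul_mem hg hγ)
  simp only [sub_mul, mul_sub, map_sub] at hT
  linear_combination h.trace_left _ (S.mul_mem hp hc) - hT

theorem trace_mul_twoSidedAction_skew (h : IsIsotropicPair tr S T) {D Ξ₁ Ξ₂ : A} {p₁ p₂ : A × A}
    (hp₁ : p₁ ∈ S) (hp₂ : p₂ ∈ S) (hg₁ : gradientPair D Ξ₁ - p₁ ∈ T)
    (hg₂ : gradientPair D Ξ₂ - p₂ ∈ T) :
    tr (Ξ₁ * twoSidedAction p₂ D) = -tr (Ξ₂ * twoSidedAction p₁ D) := by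
  rw [trace_mul_twoSidedAction h.trace_comm, trace_mul_twoSidedAction h.trace_comm,
    h.doubleTrace_mul_of_sub_mem hp₁ hg₁ hp₂ hg₂, gradientPair_mul_gradientPair,
    doubleTrace_gradientPair h.trace_comm, doubleTrace_mul_comm h.trace_comm p₁, zero_sub]

theorem sum_doubleTrace_commutator (h : IsIsotropicPair tr S T) {g₁ g₂ g₃ p₁ p₂ p₃ : A × A}
    (hp₁ : p₁ ∈ S) (hp₂ : p₂ ∈ S) (hp₃ : p₃ ∈ S) (hg₁ : g₁ - p₁ ∈ T) (hg₂ : g₂ - p₂ ∈ T)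
    (hg₃ : g₃ - p₃ ∈ T) (hg : doubleTrace tr (g₁ * (g₂ * g₃ - g₃ * g₂)) = 0) :
    doubleTrace tr (g₁ * (p₂ * p₃ - p₃ * p₂)) + doubleTrace tr (g₂ * (p₃ * p₁ - p₁ * p₃))
        + doubleTrace tr (g₃ * (p₁ * p₂ - p₂ * p₁))
      = doubleTrace tr (p₁ * (g₂ * g₃ - g₃ * g₂)) + doubleTrace tr (p₂ * (g₃ * g₁ - g₁ * g₃))
        + doubleTrace tr (p₃ * (g₁ * g₂ - g₂ * g₁)) := by
  have hcyc (x y z : A × A) : doubleTrace tr (x * (y * z)) = doubleTrace tr (y * (z * x)) := by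
    rw [doubleTrace_mul_comm h.trace_comm, mul_assoc]
  have hS := h.trace_left _ (S.mul_mem hp₁ (S.mul_mem hp₂ hp₃))
  have hS' := h.trace_left _ (S.mul_mem hp₁ (S.mul_mem hp₃ hp₂))
  have hT := h.trace_right _ (T.mul_mem hg₁ (T.mul_mem hg₂ hg₃))
  have hT' := h.trace_right _ (T.mul_mem hg₁ (T.mul_mem hg₃ hg₂))
  simp only [mul_sub, sub_mul, map_sub] at hT hT' hg ⊢
  linear_combination hT - hT' - hg + hS - hS' - hcyc p₁ g₂ p₃ + hcyc g₃ p₁ p₂ + hcyc g₁ p₂ g₃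
    - hcyc p₃ g₁ g₂ - hcyc g₂ p₁ p₃ + hcyc p₁ g₃ p₂ - hcyc g₁ p₃ g₂ + hcyc p₂ g₁ g₃

theorem trace_mul_twoSidedAction_of_sub_mem (h : IsIsotropicPair tr S T) {D Ξ₁ Ξ₂ : A}
    {p₁ p₃ c : A × A} (hp₁ : p₁ ∈ S) (hg₁ : gradientPair D Ξ₁ - p₁ ∈ T) (hc : c ∈ S)
    (hγ : gradientPair (twoSidedAction p₃ D) Ξ₂ - c ∈ T) :
    tr (Ξ₁ * twoSidedAction c D) =
      -doubleTrace tr (p₃ * (gradientPair D Ξ₁ * gradientPair D Ξ₂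
          - gradientPair D Ξ₂ * gradientPair D Ξ₁))
        - tr (Ξ₂ * twoSidedAction p₁ (twoSidedAction p₃ D)) := by
  have hcyc (x y z : A × A) : doubleTrace tr (x * (y * z)) = doubleTrace tr (z * (x * y)) := by
    rw [← mul_assoc, doubleTrace_mul_comm h.trace_comm]
  rw [trace_mul_twoSidedAction h.trace_comm, h.doubleTrace_mul_of_sub_mem hp₁ hg₁ hc hγ,
    doubleTrace_mul_comm h.trace_comm (gradientPair D Ξ₁), doubleTrace_mul_comm h.trace_comm p₁,
    ← trace_mul_twoSidedAction h.trace_comm, ← trace_mul_twoSidedAction h.trace_comm,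
    twoSidedAction_gradientPair_twoSidedAction, trace_mul_twoSidedAction h.trace_comm]
  simp only [mul_sub, map_sub]
  linear_combination hcyc (gradientPair D Ξ₂) (gradientPair D Ξ₁) p₃
    + hcyc p₃ (gradientPair D Ξ₁) (gradientPair D Ξ₂)

/-- If `pᵢ` depends on `D` through its gradient pair, then `cᵢⱼ` is the derivative of `pᵢ` along
`twoSidedAction pⱼ D`: this is the Jacobi identity of the bracket
`tr (Ξ₁ (twoSidedAction p₂ D))`. -/
theorem jacobi (h : IsIsotropicPair tr S T) {D Ξ₁ Ξ₂ Ξ₃ : A}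
    {p₁ p₂ p₃ c₁₂ c₂₃ c₃₁ : A × A} (hp₁ : p₁ ∈ S) (hp₂ : p₂ ∈ S) (hp₃ : p₃ ∈ S)
    (hg₁ : gradientPair D Ξ₁ - p₁ ∈ T) (hg₂ : gradientPair D Ξ₂ - p₂ ∈ T)
    (hg₃ : gradientPair D Ξ₃ - p₃ ∈ T) (hc₁₂ : c₁₂ ∈ S) (hc₂₃ : c₂₃ ∈ S) (hc₃₁ : c₃₁ ∈ S)
    (hγ₁₂ : gradientPair (twoSidedAction p₂ D) Ξ₁ - c₁₂ ∈ T)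
    (hγ₂₃ : gradientPair (twoSidedAction p₃ D) Ξ₂ - c₂₃ ∈ T)
    (hγ₃₁ : gradientPair (twoSidedAction p₁ D) Ξ₃ - c₃₁ ∈ T) :
    tr (Ξ₁ * (twoSidedAction c₂₃ D + twoSidedAction p₂ (twoSidedAction p₃ D)))
      + tr (Ξ₂ * (twoSidedAction c₃₁ D + twoSidedAction p₃ (twoSidedAction p₁ D)))
      + tr (Ξ₃ * (twoSidedAction c₁₂ D + twoSidedAction p₁ (twoSidedAction p₂ D))) = 0 := by
  have hcomm (Ξ : A) (p q : A × A) : tr (Ξ * twoSidedAction p (twoSidedAction q D))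
      - tr (Ξ * twoSidedAction q (twoSidedAction p D))
        = doubleTrace tr (gradientPair D Ξ * (p * q - q * p)) := by
    rw [← map_sub, ← mul_sub, twoSidedAction_commutator, trace_mul_twoSidedAction h.trace_comm]
  have hsum := h.sum_doubleTrace_commutator hp₁ hp₂ hp₃ hg₁ hg₂ hg₃ (by
    simp only [gradientPair_mul_gradientPair, mul_sub, map_sub,
      doubleTrace_gradientPair h.trace_comm, sub_zero])
  simp only [mul_add, map_add, h.trace_mul_twoSidedAction_of_sub_mem hp₁ hg₁ hc₂₃ hγ₂₃,
    h.trace_mul_twoSidedAction_of_sub_mem hp₂ hg₂ hc₃₁ hγ₃₁,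
    h.trace_mul_twoSidedAction_of_sub_mem hp₃ hg₃ hc₁₂ hγ₁₂]
  linear_combination hsum + hcomm Ξ₁ p₂ p₃ + hcomm Ξ₂ p₃ p₁ + hcomm Ξ₃ p₁ p₂

end IsIsotropicPair

end QuadraticBracket

/-! ### Difference operators -/

section DifferenceOperators

variable {N : ℕ}

instance shiftAction (N : ℕ) : MulSemiringAction (Multiplicative ℤ) (ZMod N → ℝ) where
  smul g x := fun n => x (n + (g.toAdd : ZMod N))
  one_smul x := funext fun n => congrArg x (by simp)
  mul_smul g h x := funext fun n => congrArg x (by simp [add_assoc])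
  smul_zero _ := rfl
  smul_add _ _ _ := rfl
  smul_one _ := rfl
  smul_mul _ _ _ := rfl

/-- Difference operators `∑ₖ xₖ Tᵏ` with `N`-periodic coefficients, `T` being the shift. -/
abbrev DiffOp (N : ℕ) : Type :=
  SkewMonoidAlgebra (ZMod N → ℝ) (Multiplicative ℤ)

/-- The shift of a periodic sequence by `k`. -/
def shift (k : ℤ) : (ZMod N → ℝ) →ₗ[ℝ] (ZMod N → ℝ) where
  toFun x := fun n => x (n + (k : ZMod N))
  map_add' _ _ := rfl
  map_smul' _ _ := rfl

theorem shift_apply (k : ℤ) (x : ZMod N → ℝ) (n : ZMod N) :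
    shift k x n = x (n + (k : ZMod N)) := rfl

theorem shift_zero (x : ZMod N → ℝ) : shift 0 x = x := by
  funext n
  simp [shift_apply]

theorem shift_mul (k : ℤ) (x y : ZMod N → ℝ) : shift k (x * y) = shift k x * shift k y := rfl

theorem shift_shift (j k : ℤ) (x : ZMod N → ℝ) : shift j (shift k x) = shift (j + k) x := by
  funext n
  simp [shift_apply, add_assoc]

theorem sum_shift [NeZero N] (k : ℤ) (x : ZMod N → ℝ) : ∑ n, shift k x n = ∑ n, x n :=
  Equiv.sum_comp (Equiv.addRight (k : ZMod N)) x

namespace DiffOp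

/-- The coefficient of `Tᵏ`. -/
def coeff (k : ℤ) : DiffOp N →ₗ[ℝ] (ZMod N → ℝ) where
  toFun x := SkewMonoidAlgebra.coeff x (Multiplicative.ofAdd k)
  map_add' _ _ := by simp
  map_smul' _ _ := by simp

/-- The monomial `x Tᵏ`. -/
def monomial (k : ℤ) : (ZMod N → ℝ) →ₗ[ℝ] DiffOp N where
  toFun x := SkewMonoidAlgebra.single (Multiplicative.ofAdd k) x
  map_add' _ _ := by simp
  map_smul' _ _ := by simp [SkewMonoidAlgebra.smul_single]

theorem ext_coeff {x y : DiffOp N} (h : ∀ k, coeff k x = coeff k y) : x = y :=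
  SkewMonoidAlgebra.ext fun g => h g.toAdd

theorem induction_monomial {p : DiffOp N → Prop} (x : DiffOp N) (hm : ∀ k y, p (monomial k y))
    (ha : ∀ x y, p x → p y → p (x + y)) : p x :=
  SkewMonoidAlgebra.induction_on x (by simpa only [map_zero] using hm 0 0)
    (fun g y => hm g.toAdd y) fun x y => ha x y

theorem coeff_monomial (j k : ℤ) (x : ZMod N → ℝ) :
    coeff j (monomial k x) = if j = k then x else 0 := by
  classical
  change SkewMonoidAlgebra.coeff (.single (Multiplicative.ofAdd k) x) (Multiplicative.ofAdd j) = _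
  rw [SkewMonoidAlgebra.coeff_single_apply]
  simp [eq_comm]

theorem coeff_monomial_mul (j k : ℤ) (x : ZMod N → ℝ) (y : DiffOp N) :
    coeff j (monomial k x * y) = x * shift k (coeff (j - k) y) := by
  rw [← neg_add_eq_sub]
  exact SkewMonoidAlgebra.coeff_single_mul ..

theorem coeff_mul_monomial (j k : ℤ) (x : ZMod N → ℝ) (y : DiffOp N) :
    coeff j (y * monomial k x) = coeff (j - k) y * shift (j - k) x :=
  SkewMonoidAlgebra.coeff_mul_single ..

theorem monomial_zero_one : monomial 0 1 = (1 : DiffOp N) := rfl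

instance : IsScalarTower ℝ (DiffOp N) (DiffOp N) where
  smul_assoc c x y := by
    simp only [smul_eq_mul]
    induction x using induction_monomial with
    | hm k x =>
      refine ext_coeff fun j => ?_
      rw [← map_smul, map_smul (coeff j), coeff_monomial_mul, coeff_monomial_mul, smul_mul_assoc]
    | ha x x' hx hx' => rw [smul_add, add_mul, add_mul, smul_add, hx, hx']

instance : SMulCommClass ℝ (DiffOp N) (DiffOp N) where
  smul_comm c x y := by
    simp only [smul_eq_mul]
    induction x using induction_monomial with
    | hm k x =>
      refine ext_coeff fun j => ?_
      rw [map_smul (coeff j), coeff_monomial_mul, coeff_monomial_mul, map_smul, map_smul,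
        mul_smul_comm]
    | ha x x' hx hx' => rw [add_mul, add_mul, smul_add, hx, hx']

theorem coeff_mul_of_forall_ne {a k : ℤ} {x y : DiffOp N}
    (h : ∀ i, i ≠ a → coeff i x = 0 ∨ coeff (k - i) y = 0) :
    coeff k (x * y) = coeff a x * shift a (coeff (k - a) y) := by
  have hterm (i : ℤ) : coeff i x * shift i (coeff (k - i) y) = SkewMonoidAlgebra.coeff x (.ofAdd i)
      * Multiplicative.ofAdd i • SkewMonoidAlgebra.coeff y ((.ofAdd i)⁻¹ * .ofAdd k) := by
    rw [← neg_add_eq_sub]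
    rfl
  refine (SkewMonoidAlgebra.coeff_mul_left x y _).trans <| .trans
    (Finset.sum_eq_single (.ofAdd a) (fun g _ hg => ?_) fun ha => ?_) (hterm a).symm
  · refine (hterm g.toAdd).symm.trans ?_
    obtain hi | hi := h g.toAdd hg
    · rw [hi, zero_mul]
    · rw [hi, map_zero, mul_zero]
  · rw [SkewMonoidAlgebra.notMem_support_iff.1 ha]
    exact zero_mul _

theorem coeff_mul_eq_zero {k : ℤ} {x y : DiffOp N}
    (h : ∀ i, coeff i x = 0 ∨ coeff (k - i) y = 0) : coeff k (x * y) = 0 := by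
  rw [coeff_mul_of_forall_ne (a := 0) fun i _ => h i]
  obtain h₀ | h₀ := h 0
  · rw [h₀, zero_mul]
  · rw [h₀, map_zero, mul_zero]

theorem coeff_mul_of_lt {a b k : ℤ} {x y : DiffOp N} (hx : ∀ k < a, coeff k x = 0)
    (hy : ∀ k < b, coeff k y = 0) (hk : k < a + b) : coeff k (x * y) = 0 :=
  coeff_mul_eq_zero fun i => (lt_or_ge i a).imp (hx i) fun h => hy _ (by omega)

theorem coeff_mul_of_gt {a b k : ℤ} {x y : DiffOp N} (hx : ∀ k > a, coeff k x = 0)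
    (hy : ∀ k > b, coeff k y = 0) (hk : a + b < k) : coeff k (x * y) = 0 :=
  coeff_mul_eq_zero fun i => (lt_or_ge a i).imp (hx i) fun h => hy _ (by omega)

theorem coeff_mul_add_of_lt {a b : ℤ} {x y : DiffOp N} (hx : ∀ k < a, coeff k x = 0)
    (hy : ∀ k < b, coeff k y = 0) : coeff (a + b) (x * y) = coeff a x * shift a (coeff b y) := by
  rw [coeff_mul_of_forall_ne (a := a) fun i hi =>
    hi.lt_or_gt.imp (hx i) fun h => hy _ (by omega), add_sub_cancel_left]

theorem coeff_mul_add_of_gt {a b : ℤ} {x y : DiffOp N} (hx : ∀ k > a, coeff k x = 0)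
    (hy : ∀ k > b, coeff k y = 0) : coeff (a + b) (x * y) = coeff a x * shift a (coeff b y) := by
  rw [coeff_mul_of_forall_ne (a := a) fun i hi =>
    hi.gt_or_lt.imp (hx i) fun h => hy _ (by omega), add_sub_cancel_left]

/-- The trace of a difference operator: the sum of the coefficients of `T⁰` over a period. -/
def trace [NeZero N] : DiffOp N →ₗ[ℝ] ℝ :=
  (∑ n, LinearMap.proj n : (ZMod N → ℝ) →ₗ[ℝ] ℝ) ∘ₗ coeff 0

theorem trace_apply [NeZero N] (x : DiffOp N) : trace x = ∑ n, coeff 0 x n := by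
  simp [trace]

theorem trace_monomial_mul [NeZero N] (k : ℤ) (x : ZMod N → ℝ) (y : DiffOp N) :
    trace (monomial k x * y) = ∑ n, x n * shift k (coeff (-k) y) n := by
  rw [trace_apply, coeff_monomial_mul, zero_sub]
  rfl

theorem trace_mul_comm [NeZero N] (x y : DiffOp N) : trace (x * y) = trace (y * x) := by
  induction x using induction_monomial with
  | hm k x =>
    rw [trace_monomial_mul, trace_apply, coeff_mul_monomial, zero_sub, ← sum_shift (-k)]
    refine Finset.sum_congr rfl fun n _ => ?_
    simp [shift_apply, add_assoc, mul_comm]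
  | ha x x' hx hz => rw [add_mul, mul_add, map_add, map_add, hx, hz]

/-- The part of positive degree in `T`. -/
def posPart : DiffOp N →ₗ[ℝ] DiffOp N where
  toFun x := ⟨(SkewMonoidAlgebra.coeff x).filter fun g => 0 < g.toAdd⟩
  map_add' x y := ext_coeff fun k => by simp [coeff]
  map_smul' c x := ext_coeff fun k => by simp [coeff]

theorem coeff_posPart (k : ℤ) (x : DiffOp N) :
    coeff k (posPart x) = if 0 < k then coeff k x else 0 := by
  change ((SkewMonoidAlgebra.coeff x).filter fun g => 0 < g.toAdd) (Multiplicative.ofAdd k) = _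
  rw [Finsupp.filter_apply]
  rfl

end DiffOp

end DifferenceOperators

/-! ### An isotropic pair for the trace of difference operators -/

section UpperLowerPairs

open DiffOp

variable {N : ℕ}

/-- Pairs of operators of nonnegative degree with the same coefficient of `T⁰`. -/
def upperPairs (N : ℕ) : Subsemigroup (DiffOp N × DiffOp N) where
  carrier := {p | (∀ k < 0, coeff k p.1 = 0) ∧ (∀ k < 0, coeff k p.2 = 0) ∧
    coeff 0 p.1 = coeff 0 p.2}
  mul_mem' := by
    rintro p q ⟨hp₁, hp₂, hp⟩ ⟨hq₁, hq₂, hq⟩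
    have h₁ := coeff_mul_add_of_lt hp₁ hq₁
    have h₂ := coeff_mul_add_of_lt hp₂ hq₂
    rw [add_zero] at h₁ h₂
    exact ⟨fun k hk => coeff_mul_of_lt hp₁ hq₁ (by simpa only [add_zero] using hk),
      fun k hk => coeff_mul_of_lt hp₂ hq₂ (by simpa only [add_zero] using hk),
      by rw [Prod.fst_mul, Prod.snd_mul, h₁, h₂, hp, hq]⟩

/-- Pairs of operators of nonpositive degree with coefficients of `T⁰` intertwined by `Tᵐ`. -/
def lowerPairs (N : ℕ) (m : ℤ) : Subsemigroup (DiffOp N × DiffOp N) where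
  carrier := {p | (∀ k > 0, coeff k p.1 = 0) ∧ (∀ k > 0, coeff k p.2 = 0) ∧
    coeff 0 p.1 = shift m (coeff 0 p.2)}
  mul_mem' := by
    rintro p q ⟨hp₁, hp₂, hp⟩ ⟨hq₁, hq₂, hq⟩
    have h₁ := coeff_mul_add_of_gt hp₁ hq₁
    have h₂ := coeff_mul_add_of_gt hp₂ hq₂
    rw [add_zero, shift_zero] at h₁ h₂
    exact ⟨fun k hk => coeff_mul_of_gt hp₁ hq₁ (by simpa only [add_zero] using hk),
      fun k hk => coeff_mul_of_gt hp₂ hq₂ (by simpa only [add_zero] using hk),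
      by rw [Prod.fst_mul, Prod.snd_mul, h₁, h₂, hp, hq, shift_mul]⟩

theorem isIsotropicPair_upperPairs_lowerPairs [NeZero N] (m : ℤ) :
    IsIsotropicPair (trace (N := N)).toAddMonoidHom (upperPairs N) (lowerPairs N m) where
  trace_comm := trace_mul_comm
  trace_left := by
    rintro p ⟨-, -, hp⟩
    change trace p.1 - trace p.2 = 0
    rw [trace_apply, trace_apply, hp, sub_self]
  trace_right := by
    rintro p ⟨-, -, hp⟩
    change trace p.1 - trace p.2 = 0
    rw [trace_apply, trace_apply, hp, sum_shift, sub_self]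

theorem sum_range_zmod_natCast {M : Type*} [AddCommMonoid M] [NeZero N] (g : ZMod N → M) :
    ∑ j ∈ Finset.range N, g j = ∑ z, g z :=
  Finset.sum_nbij' (fun j => (j : ZMod N)) ZMod.val (fun _ _ => Finset.mem_univ _)
    (fun z _ => Finset.mem_range.2 z.val_lt)
    (fun _ hj => ZMod.val_cast_of_lt (Finset.mem_range.1 hj))
    (fun z _ => ZMod.natCast_zmod_val z) fun _ _ => rfl

theorem sum_range_zmod_add_succ_mul {M : Type*} [AddCommMonoid M] [NeZero N] {m : ℕ}
    (hm : Nat.Coprime N m) (g : ZMod N → M) (n : ZMod N) :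
    ∑ j ∈ Finset.range N, g (n + ((j : ZMod N) + 1) * m) = ∑ z, g z := by
  have hu : IsUnit (m : ZMod N) := (ZMod.isUnit_iff_coprime m N).2 hm.symm
  have hbij : Function.Bijective fun z : ZMod N => n + (z + 1) * m :=
    Finite.injective_iff_bijective.1 fun z w h =>
      add_right_cancel (hu.mul_right_cancel (add_left_cancel h))
  exact (sum_range_zmod_natCast fun z : ZMod N => g (n + (z + 1) * m)).trans (hbij.sum_comp g)

theorem sum_range_natCast_mul_succ {R : Type*} [CommRing R] (N : ℕ) (s : ℕ → R) :
    ∑ j ∈ Finset.range N, (j : R) * s (j + 1) =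
      ∑ j ∈ Finset.range N, (j : R) * s j + N * s N - ∑ j ∈ Finset.range N, s (j + 1) := by
  induction N with
  | zero => simp
  | succ N ih =>
    rw [Finset.sum_range_succ, Finset.sum_range_succ, Finset.sum_range_succ, ih]
    push_cast
    ring

/-- A solution operator for the equation `y - Tᵐ y = x` on sequences of sum zero. -/
def solveShift (N : ℕ) (m : ℤ) : (ZMod N → ℝ) →ₗ[ℝ] (ZMod N → ℝ) :=
  -((N : ℝ)⁻¹ • ∑ j ∈ Finset.range N, (j : ℝ) • shift (j * m))

theorem solveShift_sub_shift [NeZero N] {m : ℕ} (hm : Nat.Coprime N m) {x : ZMod N → ℝ}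
    (hx : ∑ n, x n = 0) : solveShift N m x - shift m (solveShift N m x) = x := by
  funext n
  let s : ℕ → ℝ := fun j => x (n + j * m)
  have hsolve : solveShift N m x n = -((N : ℝ)⁻¹ * ∑ j ∈ Finset.range N, (j : ℝ) * s j) := by
    simp [solveShift, shift_apply, s]
  have hshift : shift m (solveShift N m x) n =
      -((N : ℝ)⁻¹ * ∑ j ∈ Finset.range N, (j : ℝ) * s (j + 1)) := by
    simp [solveShift, shift_apply, s, add_mul, add_assoc, add_comm]
  have horbit : ∑ j ∈ Finset.range N, s (j + 1) = 0 := by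
    simpa [s, hx] using sum_range_zmod_add_succ_mul hm x n
  have hN : (N : ℝ) ≠ 0 := Nat.cast_ne_zero.2 (NeZero.ne N)
  calc solveShift N m x n - shift m (solveShift N m x) n = s N := by
        rw [hsolve, hshift, sum_range_natCast_mul_succ, horbit]
        field_simp
        ring
    _ = x n := by simp [s]

/-- The projection of a pair of operators of equal trace to the pairs of nonnegative degree, along
the pairs of nonpositive degree. The coefficient `y` of `T⁰` solves `y - Tᵐ y = x₁ - Tᵐ x₂`, where
`x₁` and `x₂` are the coefficients of `T⁰` in the given pair. -/
def upperProjection (m : ℤ) : DiffOp N × DiffOp N →ₗ[ℝ] DiffOp N × DiffOp N :=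
  let free := monomial 0 ∘ₗ solveShift N m ∘ₗ
    (coeff 0 ∘ₗ LinearMap.fst ℝ _ _ - shift m ∘ₗ coeff 0 ∘ₗ LinearMap.snd ℝ _ _)
  (posPart ∘ₗ LinearMap.fst ℝ _ _ + free).prod (posPart ∘ₗ LinearMap.snd ℝ _ _ + free)

theorem upperProjection_apply (m : ℤ) (p : DiffOp N × DiffOp N) :
    upperProjection m p =
      (posPart p.1 + monomial 0 (solveShift N m (coeff 0 p.1 - shift m (coeff 0 p.2))),
        posPart p.2 + monomial 0 (solveShift N m (coeff 0 p.1 - shift m (coeff 0 p.2)))) := rfl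

theorem upperProjection_fst_sub_snd (m : ℤ) (p : DiffOp N × DiffOp N) :
    (upperProjection m p).1 - (upperProjection m p).2 = posPart (p.1 - p.2) :=
  (add_sub_add_right_eq_sub _ _ _).trans (map_sub posPart _ _).symm

theorem upperProjection_mem (m : ℤ) (p : DiffOp N × DiffOp N) :
    upperProjection m p ∈ upperPairs N := by
  rw [upperProjection_apply]
  refine ⟨fun k hk => ?_, fun k hk => ?_, ?_⟩
  · simp [coeff_posPart, coeff_monomial, hk.ne, hk.le.not_gt]
  · simp [coeff_posPart, coeff_monomial, hk.ne, hk.le.not_gt]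
  · simp [coeff_posPart, coeff_monomial]

theorem sub_upperProjection_mem [NeZero N] {m : ℕ} (hm : Nat.Coprime N m)
    {p : DiffOp N × DiffOp N} (hp : trace p.1 = trace p.2) :
    p - upperProjection m p ∈ lowerPairs N m := by
  rw [upperProjection_apply]
  refine ⟨fun k hk => ?_, fun k hk => ?_, ?_⟩
  · simp [coeff_posPart, coeff_monomial, hk, hk.ne']
  · simp [coeff_posPart, coeff_monomial, hk, hk.ne']
  · have hsum : ∑ n, (coeff 0 p.1 - shift m (coeff 0 p.2)) n = 0 := by
      simp only [Pi.sub_apply, Finset.sum_sub_distrib, sum_shift, ← trace_apply, hp, sub_self]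
    have hsolve := solveShift_sub_shift hm hsum
    simp only [Prod.fst_sub, Prod.snd_sub, map_sub, map_add, coeff_posPart, coeff_monomial,
      lt_irrefl, if_false, if_true, zero_add] at hsolve ⊢
    linear_combination -hsolve

end UpperLowerPairs

section AffineBilinear

variable {E F M : Type*} [NormedAddCommGroup E] [NormedSpace ℝ E] [FiniteDimensional ℝ E]
  [NormedAddCommGroup F] [NormedSpace ℝ F] [AddCommGroup M] [Module ℝ M]

theorem bilin_affine_eq (B : M →ₗ[ℝ] M →ₗ[ℝ] F) (c : M) (ι : E →ₗ[ℝ] M) :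
    (fun a => B (c + ι a) (c + ι a)) = fun a =>
      B c c + (B c ∘ₗ ι + B.flip c ∘ₗ ι).toContinuousLinearMap a
        + (B.compl₁₂ ι ι).toContinuousBilinearMap a a := by
  funext a
  simp only [map_add, LinearMap.add_apply, add_apply, LinearMap.coe_toContinuousLinearMap',
    LinearMap.coe_comp, Function.comp_apply, LinearMap.flip_apply, LinearMap.compl₁₂_apply,
    LinearMap.toContinuousBilinearMap_apply]
  abel

theorem contDiff_bilin_affine (B : M →ₗ[ℝ] M →ₗ[ℝ] F) (c : M) (ι : E →ₗ[ℝ] M)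
    {n : WithTop ℕ∞} : ContDiff ℝ n fun a => B (c + ι a) (c + ι a) := by
  rw [bilin_affine_eq]
  fun_prop

theorem fderiv_bilin_affine (B : M →ₗ[ℝ] M →ₗ[ℝ] F) (c : M) (ι : E →ₗ[ℝ] M) (a v : E) :
    fderiv ℝ (fun a => B (c + ι a) (c + ι a)) a v = B (ι v) (c + ι a) + B (c + ι a) (ι v) := by
  have hlin := (B c ∘ₗ ι + B.flip c ∘ₗ ι).toContinuousLinearMap.hasFDerivAt (x := a)
  have hquad := (B.compl₁₂ ι ι).toContinuousBilinearMap.hasFDerivAt_of_bilinear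
    (hasFDerivAt_id a) (hasFDerivAt_id a)
  rw [bilin_affine_eq]
  refine (DFunLike.congr_fun ((hlin.const_add (B c c)).add hquad).fderiv v).trans ?_
  change B c (ι v) + B (ι v) c + (B (ι a) (ι v) + B (ι v) (ι a)) = _
  simp only [map_add, LinearMap.add_apply]
  abel

end AffineBilinear

/-! ### The Hamiltonian operators of the lattice `W`-algebra -/

section HamiltonianOperator

open DiffOp

variable {d N : ℕ}

/-- The operator `-∑ᵣ aʳ Tʳ`. -/
def invariantsOp : Invariants d N →ₗ[ℝ] DiffOp N :=
  -∑ r : Fin d, monomial (r + 1) ∘ₗ LinearMap.pi fun n => LinearMap.proj r ∘ₗ LinearMap.proj n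

/-- The invariants read off from an operator `-∑ᵣ aʳ Tʳ`. -/
def readInvariants : DiffOp N →ₗ[ℝ] Invariants d N :=
  -LinearMap.pi fun n => LinearMap.pi fun r : Fin d => LinearMap.proj n ∘ₗ coeff (r + 1)

theorem readInvariants_apply (x : DiffOp N) (n : ZMod N) (r : Fin d) :
    readInvariants x n r = -coeff (r + 1) x n := rfl

theorem coeff_invariantsOp (k : ℤ) (a : Invariants d N) :
    coeff k (invariantsOp a) = -∑ r : Fin d, if k = r + 1 then fun n => a n r else 0 := by
  simp only [invariantsOp, LinearMap.neg_apply, LinearMap.sum_apply, map_neg, map_sum,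
    LinearMap.comp_apply, coeff_monomial]
  rfl

theorem coeff_invariantsOp_fin (r : Fin d) (a : Invariants d N) :
    coeff (r + 1) (invariantsOp a) = fun n => -a n r := by
  rw [coeff_invariantsOp, Finset.sum_eq_single r]
  · simp only [if_true]; rfl
  · intro s _ hs
    rw [if_neg fun h => hs (Fin.ext (by omega))]
  · simp

theorem coeff_invariantsOp_of_nonpos {k : ℤ} (hk : k ≤ 0) (a : Invariants d N) :
    coeff k (invariantsOp a) = 0 := by
  rw [coeff_invariantsOp, Finset.sum_eq_zero fun r _ => if_neg (by omega), neg_zero]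

theorem coeff_invariantsOp_of_gt {k : ℤ} (hk : d < k) (a : Invariants d N) :
    coeff k (invariantsOp a) = 0 := by
  rw [coeff_invariantsOp, Finset.sum_eq_zero fun r _ => if_neg (by omega), neg_zero]

theorem invariantsOp_readInvariants {x : DiffOp N} (h₀ : ∀ k ≤ 0, coeff k x = 0)
    (h₁ : ∀ k : ℤ, d < k → coeff k x = 0) :
    invariantsOp (readInvariants x : Invariants d N) = x := by
  refine ext_coeff fun k => ?_
  rcases le_or_gt k 0 with hk | hk
  · rw [coeff_invariantsOp_of_nonpos hk, h₀ k hk]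
  rcases lt_or_ge (d : ℤ) k with hk' | hk'
  · rw [coeff_invariantsOp_of_gt hk', h₁ k hk']
  obtain ⟨r, rfl⟩ : ∃ r : Fin d, k = r + 1 := ⟨⟨(k - 1).toNat, by omega⟩, by simp only; omega⟩
  rw [coeff_invariantsOp_fin]
  funext n
  rw [readInvariants_apply, neg_neg]

/-- The operator `Tᵐ - ∑ᵣ aʳ Tʳ + e` with `m = d + 1`. Up to sign, the one with `e = (-1)^m`
annihilates the polygon with invariants `a`. -/
def laxOp (e : ℝ) (a : Invariants d N) : DiffOp N :=
  monomial (d + 1) 1 + e • 1 + invariantsOp a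

theorem coeff_laxOp (e : ℝ) (a : Invariants d N) (k : ℤ) :
    coeff k (laxOp e a) = (if k = d + 1 then 1 else 0) + e • (if k = 0 then 1 else 0)
      + coeff k (invariantsOp a) := by
  simp only [laxOp, map_add, map_smul, coeff_monomial, ← monomial_zero_one]

theorem coeff_laxOp_of_neg (e : ℝ) (a : Invariants d N) {k : ℤ} (hk : k < 0) :
    coeff k (laxOp e a) = 0 := by
  simp [coeff_laxOp, hk.ne, coeff_invariantsOp_of_nonpos hk.le, show k ≠ d + 1 by omega]

theorem coeff_laxOp_of_gt (e : ℝ) (a : Invariants d N) {k : ℤ} (hk : k > d + 1) :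
    coeff k (laxOp e a) = 0 := by
  simp [coeff_laxOp, hk.ne', coeff_invariantsOp_of_gt (show (d : ℤ) < k by omega),
    show k ≠ 0 by omega]

theorem coeff_laxOp_top (e : ℝ) (a : Invariants d N) : coeff (d + 1) (laxOp e a) = 1 := by
  simp [coeff_laxOp, coeff_invariantsOp_of_gt (lt_add_one (d : ℤ)),
    show (d : ℤ) + 1 ≠ 0 by omega]

/-- A covector as the operator `∑ᵣ T⁻ʳ ξᵣ`. -/
def covectorOp : (Invariants d N →L[ℝ] ℝ) →ₗ[ℝ] DiffOp N :=
  ∑ r : Fin d, monomial (-(r + 1)) ∘ₗ shift (-(r + 1)) ∘ₗ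
    { toFun := fun ξ n => ξ (Pi.single n (Pi.single r 1))
      map_add' := fun _ _ => rfl
      map_smul' := fun _ _ => rfl }

theorem covectorOp_apply (ξ : Invariants d N →L[ℝ] ℝ) :
    covectorOp ξ = ∑ r : Fin d, monomial (-(r + 1))
      (shift (-(r + 1)) fun n => ξ (Pi.single n (Pi.single r 1))) := by
  rw [covectorOp, LinearMap.sum_apply]
  rfl

theorem coeff_covectorOp_of_nonneg (ξ : Invariants d N →L[ℝ] ℝ) {k : ℤ} (hk : 0 ≤ k) :
    coeff k (covectorOp ξ) = 0 := by
  rw [covectorOp_apply, map_sum]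
  exact Finset.sum_eq_zero fun r _ => by rw [coeff_monomial, if_neg (by omega)]

/-- The quadratic vector field `D ↦ p₁ D - D p₂`, where `(p₁, p₂)` is the nonnegative part of the
gradient pair `(D Ξ, Ξ D)`, polarized in `D`. -/
def quadField (m : ℤ) : DiffOp N →ₗ[ℝ] DiffOp N →ₗ[ℝ] DiffOp N →ₗ[ℝ] DiffOp N :=
  LinearMap.mk₂ ℝ
    (fun D D' =>
      { toFun := fun Ξ => twoSidedAction (upperProjection m (gradientPair D Ξ)) D'
        map_add' := fun Ξ Ξ' => by
          simp only [twoSidedAction, gradientPair, mul_add, add_mul, ← Prod.mk_add_mk, map_add,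
            Prod.fst_add, Prod.snd_add]
          abel
        map_smul' := fun c Ξ => by
          simp only [twoSidedAction, gradientPair, mul_smul_comm, smul_mul_assoc, ← Prod.smul_mk,
            map_smul, Prod.smul_fst, Prod.smul_snd, smul_sub, RingHom.id_apply] })
    (fun D₁ D₂ D' => LinearMap.ext fun Ξ => by
      simp only [LinearMap.coe_mk, AddHom.coe_mk, LinearMap.add_apply, twoSidedAction,
        gradientPair, mul_add, add_mul, ← Prod.mk_add_mk, map_add, Prod.fst_add, Prod.snd_add]
      abel)
    (fun c D D' => LinearMap.ext fun Ξ => by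
      simp only [LinearMap.coe_mk, AddHom.coe_mk, LinearMap.smul_apply, twoSidedAction,
        gradientPair, mul_smul_comm, smul_mul_assoc, ← Prod.smul_mk, map_smul, Prod.smul_fst,
        Prod.smul_snd, smul_sub])
    (fun D D₁ D₂ => LinearMap.ext fun Ξ => by
      simp only [LinearMap.coe_mk, AddHom.coe_mk, LinearMap.add_apply, twoSidedAction, mul_add,
        add_mul]
      abel)
    (fun c D D' => LinearMap.ext fun Ξ => by
      simp only [LinearMap.coe_mk, AddHom.coe_mk, LinearMap.smul_apply, twoSidedAction,
        mul_smul_comm, smul_mul_assoc, smul_sub])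

theorem quadField_apply (m : ℤ) (D D' Ξ : DiffOp N) :
    quadField m D D' Ξ = twoSidedAction (upperProjection m (gradientPair D Ξ)) D' := rfl

variable [NeZero N]

theorem covector_apply (ξ : Invariants d N →L[ℝ] ℝ) (v : Invariants d N) :
    ξ v = ∑ n, ∑ r, ξ (Pi.single n (Pi.single r 1)) * v n r := by
  have hv : v = ∑ n, ∑ r, v n r • (Pi.single n (Pi.single r (1 : ℝ)) : Invariants d N) := by
    funext n r
    simp [Finset.sum_apply, Pi.single_apply, apply_ite, ite_apply]
  conv_lhs => rw [hv]
  simp [map_sum, mul_comm]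

theorem trace_covectorOp_mul (ξ : Invariants d N →L[ℝ] ℝ) (x : DiffOp N) :
    trace (covectorOp ξ * x) = -ξ (readInvariants x) := by
  rw [covector_apply, covectorOp_apply, Finset.sum_mul, map_sum, Finset.sum_comm,
    ← Finset.sum_neg_distrib]
  refine Finset.sum_congr rfl fun r _ => ?_
  rw [trace_monomial_mul, neg_neg, ← Finset.sum_neg_distrib, ← sum_shift (-((r : ℤ) + 1))
    fun n => -(ξ (Pi.single n (Pi.single r 1)) * readInvariants x n r)]
  refine Finset.sum_congr rfl fun n _ => ?_
  simp only [readInvariants_apply, shift_apply]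
  ring

/-- The polarization of the Hamiltonian operator. -/
def hamiltonianBilin :
    DiffOp N →ₗ[ℝ] DiffOp N →ₗ[ℝ] ((Invariants d N →L[ℝ] ℝ) →L[ℝ] Invariants d N) :=
  (quadField (d + 1)).compr₂
    { toFun := fun f => LinearMap.toContinuousLinearMap (readInvariants ∘ₗ f ∘ₗ covectorOp)
      map_add' := fun f g => by
        ext1 ξ
        exact map_add readInvariants (f (covectorOp ξ)) (g (covectorOp ξ))
      map_smul' := fun c f => by
        ext1 ξ
        exact map_smul readInvariants c (f (covectorOp ξ)) }

/-- The Hamiltonian operator of the quadratic bracket on operators `Tᵐ - ∑ᵣ aʳ Tʳ + e`. -/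
def hamiltonian (e : ℝ) (a : Invariants d N) : (Invariants d N →L[ℝ] ℝ) →L[ℝ] Invariants d N :=
  hamiltonianBilin (laxOp e a) (laxOp e a)

theorem hamiltonian_apply (e : ℝ) (a : Invariants d N) (ξ : Invariants d N →L[ℝ] ℝ) :
    hamiltonian e a ξ =
      readInvariants (quadField (d + 1) (laxOp e a) (laxOp e a) (covectorOp ξ)) := rfl

theorem contDiff_hamiltonian (e : ℝ) : ContDiff ℝ ∞ (hamiltonian (d := d) (N := N) e) :=
  contDiff_bilin_affine (E := Invariants d N)
    (F := (Invariants d N →L[ℝ] ℝ) →L[ℝ] Invariants d N) hamiltonianBilin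
    (monomial (d + 1) 1 + e • 1) invariantsOp

theorem fderiv_hamiltonian (e : ℝ) (a v : Invariants d N) (ξ : Invariants d N →L[ℝ] ℝ) :
    fderiv ℝ (hamiltonian e) a v ξ =
      readInvariants (quadField (d + 1) (invariantsOp v) (laxOp e a) (covectorOp ξ)
        + quadField (d + 1) (laxOp e a) (invariantsOp v) (covectorOp ξ)) := by
  have h := fderiv_bilin_affine (E := Invariants d N)
    (F := (Invariants d N →L[ℝ] ℝ) →L[ℝ] Invariants d N) hamiltonianBilin
    (monomial (d + 1) 1 + e • 1) invariantsOp a v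
  exact (DFunLike.congr_fun h ξ).trans (map_add readInvariants _ _).symm

end HamiltonianOperator

section PoissonPencil

open DiffOp

variable {d N : ℕ}

theorem coeff_twoSidedAction_of_mem_upperPairs {p : DiffOp N × DiffOp N} (hp : p ∈ upperPairs N)
    {D : DiffOp N} (hD : ∀ k < 0, coeff k D = 0) {k : ℤ} (hk : k ≤ 0) :
    coeff k (twoSidedAction p D) = 0 := by
  obtain ⟨hp₁, hp₂, hp⟩ := hp
  rw [twoSidedAction, map_sub]
  obtain hk | rfl := hk.lt_or_eq
  · rw [coeff_mul_of_lt hp₁ hD (by omega), coeff_mul_of_lt hD hp₂ (by omega), sub_zero]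
  · have h₁ := coeff_mul_add_of_lt hp₁ hD
    have h₂ := coeff_mul_add_of_lt hD hp₂
    rw [add_zero, shift_zero] at h₁ h₂
    rw [h₁, h₂, hp, mul_comm, sub_self]

theorem coeff_twoSidedAction_of_mem_lowerPairs {m : ℤ} {p : DiffOp N × DiffOp N}
    (hp : p ∈ lowerPairs N m) {D : DiffOp N} (hD : ∀ k > m, coeff k D = 0) (hm : coeff m D = 1)
    {k : ℤ} (hk : m ≤ k) : coeff k (twoSidedAction p D) = 0 := by
  obtain ⟨hp₁, hp₂, hp⟩ := hp
  rw [twoSidedAction, map_sub]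
  obtain hk | rfl := hk.lt_or_eq
  · rw [coeff_mul_of_gt hp₁ hD (by omega), coeff_mul_of_gt hD hp₂ (by omega), sub_zero]
  · have h₁ := coeff_mul_add_of_gt hp₁ hD
    have h₂ := coeff_mul_add_of_gt hD hp₂
    rw [zero_add, shift_zero, hm, mul_one] at h₁
    rw [add_zero, hm, one_mul] at h₂
    rw [h₁, h₂, hp, sub_self]

theorem coeff_quadField_of_nonpos (e : ℝ) (a : Invariants d N) (Ξ : DiffOp N) {k : ℤ}
    (hk : k ≤ 0) : coeff k (quadField (d + 1) (laxOp e a) (laxOp e a) Ξ) = 0 :=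
  coeff_twoSidedAction_of_mem_upperPairs (upperProjection_mem _ _)
    (fun _ => coeff_laxOp_of_neg e a) hk

theorem upperProjection_diag_covectorOp (m : ℤ) (ξ : Invariants d N →L[ℝ] ℝ) :
    upperProjection m (covectorOp ξ, covectorOp ξ) = 0 := by
  have hpos : posPart (covectorOp ξ) = 0 := by
    refine ext_coeff fun k => ?_
    rw [coeff_posPart, map_zero]
    exact ite_eq_right_iff.2 fun hk => coeff_covectorOp_of_nonneg ξ hk.le
  rw [upperProjection_apply, hpos, coeff_covectorOp_of_nonneg ξ le_rfl]
  simp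

theorem laxOp_eq_add_smul (e : ℝ) (a : Invariants d N) :
    laxOp e a = laxOp 0 a + e • (1 : DiffOp N) := by
  rw [laxOp, laxOp, zero_smul ℝ (1 : DiffOp N)]
  abel

theorem readInvariants_posPart (x : DiffOp N) :
    (readInvariants (posPart x) : Invariants d N) = readInvariants x := by
  funext n r
  rw [readInvariants_apply, readInvariants_apply, coeff_posPart, if_pos (by omega)]

theorem upperProjection_gradientPair_laxOp (m : ℤ) (e : ℝ) (a : Invariants d N)
    (ξ : Invariants d N →L[ℝ] ℝ) :
    upperProjection m (gradientPair (laxOp e a) (covectorOp ξ)) =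
      upperProjection m (gradientPair (laxOp 0 a) (covectorOp ξ)) := by
  have hgrad : gradientPair (laxOp e a) (covectorOp ξ) =
      gradientPair (laxOp 0 a) (covectorOp ξ) + e • (covectorOp ξ, covectorOp ξ) := by
    simp only [gradientPair, laxOp_eq_add_smul e, add_mul, mul_add, smul_mul_assoc, mul_smul_comm,
      one_mul, mul_one, Prod.smul_mk, Prod.mk_add_mk]
  rw [hgrad, map_add, map_smul, upperProjection_diag_covectorOp, smul_zero, add_zero]

variable [NeZero N]

theorem hamiltonian_eq_add_smul_commutator (e : ℝ) (a : Invariants d N)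
    (ξ : Invariants d N →L[ℝ] ℝ) :
    hamiltonian e a ξ = hamiltonian 0 a ξ
      + e • readInvariants (laxOp 0 a * covectorOp ξ - covectorOp ξ * laxOp 0 a) := by
  have hsub : _ = posPart (laxOp 0 a * covectorOp ξ - covectorOp ξ * laxOp 0 a) :=
    upperProjection_fst_sub_snd (d + 1) (gradientPair (laxOp 0 a) (covectorOp ξ))
  rw [hamiltonian_apply, hamiltonian_apply, ← readInvariants_posPart (_ - _), ← map_smul, ← map_add,
    ← hsub, quadField_apply, quadField_apply, upperProjection_gradientPair_laxOp,
    laxOp_eq_add_smul e]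
  refine congrArg _ ?_
  simp only [twoSidedAction, mul_add, add_mul, mul_smul_comm, smul_mul_assoc, mul_one, one_mul,
    smul_sub]
  abel

/-- The coefficient of `e` in `hamiltonian e`: the linear bracket of the pencil. -/
def linearHamiltonian (a : Invariants d N) : (Invariants d N →L[ℝ] ℝ) →L[ℝ] Invariants d N :=
  hamiltonian 1 a - hamiltonian 0 a

theorem linearHamiltonian_apply (a : Invariants d N) (ξ : Invariants d N →L[ℝ] ℝ) :
    linearHamiltonian a ξ =
      readInvariants (laxOp 0 a * covectorOp ξ - covectorOp ξ * laxOp 0 a) := by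
  rw [linearHamiltonian, sub_apply, hamiltonian_eq_add_smul_commutator 1, one_smul,
    add_sub_cancel_left]

theorem hamiltonian_eq_add_smul (e : ℝ) :
    (hamiltonian e : Invariants d N → _) = hamiltonian 0 + e • linearHamiltonian := by
  funext a
  ext1 ξ
  rw [hamiltonian_eq_add_smul_commutator, ← linearHamiltonian_apply]
  rfl

theorem gradientPair_sub_upperProjection_mem (hcop : Nat.Coprime N (d + 1)) (D Ξ : DiffOp N) :
    gradientPair D Ξ - upperProjection (d + 1) (gradientPair D Ξ) ∈ lowerPairs N (d + 1) := by
  exact_mod_cast sub_upperProjection_mem hcop (p := gradientPair D Ξ) (trace_mul_comm D Ξ)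

theorem coeff_quadField_of_gt (hcop : Nat.Coprime N (d + 1)) (e : ℝ) (a : Invariants d N)
    (Ξ : DiffOp N) {k : ℤ} (hk : d < k) :
    coeff k (quadField (d + 1) (laxOp e a) (laxOp e a) Ξ) = 0 := by
  have h := coeff_twoSidedAction_of_mem_lowerPairs
    (gradientPair_sub_upperProjection_mem hcop (laxOp e a) Ξ) (fun _ => coeff_laxOp_of_gt e a)
    (coeff_laxOp_top e a) (Int.add_one_le_of_lt hk)
  rw [twoSidedAction_sub, twoSidedAction_gradientPair, zero_sub, map_neg, neg_eq_zero] at h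
  exact h

theorem invariantsOp_hamiltonian (hcop : Nat.Coprime N (d + 1)) (e : ℝ) (a : Invariants d N)
    (ξ : Invariants d N →L[ℝ] ℝ) :
    invariantsOp (hamiltonian e a ξ) =
      quadField (d + 1) (laxOp e a) (laxOp e a) (covectorOp ξ) :=
  invariantsOp_readInvariants (fun _ => coeff_quadField_of_nonpos e a _)
    fun _ => coeff_quadField_of_gt hcop e a _

theorem isPoissonTensor_hamiltonian (hcop : Nat.Coprime N (d + 1)) (e : ℝ) :
    IsPoissonTensor (hamiltonian e : Invariants d N → _) := by
  have hpair := isIsotropicPair_upperPairs_lowerPairs (N := N) (d + 1)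
  have hupper (D Ξ : DiffOp N) := upperProjection_mem (d + 1) (gradientPair D Ξ)
  have hlower := gradientPair_sub_upperProjection_mem (N := N) hcop
  refine ⟨contDiff_hamiltonian e, fun a ξ η => ?_, fun a ξ η ζ => ?_⟩
  · have h := hpair.trace_mul_twoSidedAction_skew (hupper (laxOp e a) (covectorOp ξ))
      (hupper _ (covectorOp η)) (hlower _ _) (hlower _ _)
    rw [hamiltonian_apply, hamiltonian_apply, ← neg_inj, ← trace_covectorOp_mul,
      ← trace_covectorOp_mul]
    exact h
  · have h := hpair.jacobi (hupper (laxOp e a) (covectorOp ξ)) (hupper _ (covectorOp η))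
      (hupper _ (covectorOp ζ)) (hlower _ _) (hlower _ _) (hlower _ _) (hupper _ (covectorOp ξ))
      (hupper _ (covectorOp η)) (hupper _ (covectorOp ζ)) (hlower _ _) (hlower _ _) (hlower _ _)
    simp only [fderiv_hamiltonian, invariantsOp_hamiltonian hcop,
      ← neg_eq_iff_eq_neg.2 (trace_covectorOp_mul _ _)]
    rw [← neg_add, ← neg_add, neg_eq_zero]
    exact h

theorem isPoissonBracket_pencil (hcop : Nat.Coprime N (d + 1)) (s t : ℝ) :
    IsPoissonBracket (s • tensorBracket (hamiltonian 0 : Invariants d N → _)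
      + t • tensorBracket linearHamiltonian) := by
  have hpencil (e : ℝ) : IsPoissonTensor
      ((hamiltonian 0 : Invariants d N → _) + e • linearHamiltonian) :=
    hamiltonian_eq_add_smul (d := d) (N := N) e ▸ isPoissonTensor_hamiltonian hcop e
  rw [← tensorBracket_smul_add_smul]
  exact (IsPoissonTensor.smul_add_smul hpencil s t).isPoissonBracket

end PoissonPencil

/-! ### The gauge action on the section -/

@[to_additive]
theorem prod_range_shift_mul {N : ℕ} {M : Type*} [CommMonoid M] (x : ZMod N → M) (n : ZMod N)
    (k : ℕ) :
    (∏ j ∈ Finset.range k, x (n + 1 + j)) * x n =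
      (∏ j ∈ Finset.range k, x (n + j)) * x (n + k) := by
  rw [← Finset.prod_range_succ, Finset.prod_range_succ']
  simp only [Nat.cast_zero, add_zero, Nat.cast_add_one, add_assoc, add_comm (1 : ZMod N)]

theorem apply_eq_apply_zero_of_add_natCast {N m : ℕ} [NeZero N] (hcop : Nat.Coprime N m)
    {α : Type*} {x : ZMod N → α} (hx : ∀ n, x (n + m) = x n) (n : ZMod N) : x n = x 0 := by
  have hmul (k : ℕ) : x (k * m) = x 0 := by
    induction k with
    | zero => simp
    | succ k ih => rw [Nat.cast_succ, add_one_mul, hx, ih]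
  obtain ⟨u, hu⟩ := (ZMod.isUnit_iff_coprime m N).2 hcop.symm
  have h := hmul (n * ↑u⁻¹ : ZMod N).val
  rwa [ZMod.natCast_zmod_val, ← hu, mul_assoc, Units.inv_mul, mul_one] at h

theorem neg_one_pow_mul_self (k : ℕ) : (-1 : ℝ) ^ k * (-1) ^ k = 1 :=
  pow_mul_pow_eq_one k (by norm_num)

section FrameMatrix

variable {d : ℕ}

theorem frameMatrix_castSucc_zero (a : Fin d → ℝ) (r : Fin d) :
    frameMatrix a r.castSucc 0 = (-1) ^ (d + 1) * a r := by
  simp [frameMatrix]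

theorem frameMatrix_last_zero (a : Fin d → ℝ) : frameMatrix a (Fin.last d) 0 = (-1) ^ d := by
  simp [frameMatrix]

theorem frameMatrix_succ (a : Fin d → ℝ) (i : Fin (d + 1)) (r : Fin d) :
    frameMatrix a i r.succ = if i = r.castSucc then 1 else 0 := by
  simp [frameMatrix]

theorem frameMatrix_mulVec_single_succ (a : Fin d → ℝ) (r : Fin d) :
    (frameMatrix a).mulVec (Pi.single r.succ 1) = Pi.single r.castSucc 1 := by
  ext i
  rw [Matrix.mulVec_single_one, Matrix.col_apply, frameMatrix_succ, Pi.single_apply]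

theorem frameMatrix_injective : Function.Injective (frameMatrix (d := d)) := by
  intro a a' h
  funext r
  have h₀ := congrFun (congrFun h r.castSucc) 0
  rw [frameMatrix_castSucc_zero, frameMatrix_castSucc_zero] at h₀
  exact mul_left_cancel₀ (pow_ne_zero _ (by norm_num)) h₀

theorem det_eq_of_forall_apply_succ {M : Matrix (Fin (d + 1)) (Fin (d + 1)) ℝ}
    (hM : ∀ i (r : Fin d), M i r.succ = if i = r.castSucc then 1 else 0) :
    M.det = (-1) ^ d * M (Fin.last d) 0 := by
  have hminor : M.submatrix (Fin.last d).succAbove (Fin.succAbove 0) = 1 := by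
    ext i j
    simp [hM, Matrix.one_apply]
  have hlast (r : Fin d) : M (Fin.last d) r.succ = 0 := by
    rw [hM, if_neg (Fin.castSucc_lt_last r).ne']
  rw [Matrix.det_succ_row _ (Fin.last d), Fin.sum_univ_succ, hminor]
  simp [hlast]

theorem frameMatrix_eq_of_forall_apply_succ {M : Matrix (Fin (d + 1)) (Fin (d + 1)) ℝ}
    (hdet : M.det = 1) (hM : ∀ i (r : Fin d), M i r.succ = if i = r.castSucc then 1 else 0) :
    frameMatrix (fun r => (-1) ^ (d + 1) * M r.castSucc 0) = M := by
  ext i j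
  cases j using Fin.cases with
  | succ r => rw [frameMatrix_succ, hM]
  | zero =>
    cases i using Fin.lastCases with
    | cast r => rw [frameMatrix_castSucc_zero, ← mul_assoc, neg_one_pow_mul_self, one_mul]
    | last =>
      rw [det_eq_of_forall_apply_succ hM] at hdet
      calc frameMatrix _ (Fin.last d) 0 = (-1) ^ d * ((-1) ^ d * M (Fin.last d) 0) := by
            rw [frameMatrix_last_zero, hdet, mul_one]
        _ = M (Fin.last d) 0 := by rw [← mul_assoc, neg_one_pow_mul_self, one_mul]

end FrameMatrix

section Transport

variable {d N : ℕ}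

theorem gauge_mul (h h' : ZMod N → parabolic d) (L : ZMod N → Grp d) :
    gauge (h * h') L = gauge h (gauge h' L) := by
  funext n
  simp only [gauge, Pi.mul_apply, Subgroup.coe_mul, mul_inv_rev, mul_assoc]

theorem gauge_one (L : ZMod N → Grp d) : gauge 1 L = L := by
  funext n
  simp [gauge]

theorem gauge_inv_gauge (h : ZMod N → parabolic d) (L : ZMod N → Grp d) :
    gauge h⁻¹ (gauge h L) = L := by
  rw [← gauge_mul, inv_mul_cancel, gauge_one]

theorem gauge_mem_regularSet (h : ZMod N → parabolic d) {L : ZMod N → Grp d}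
    (hL : L ∈ regularSet d N) : gauge h L ∈ regularSet d N := by
  obtain ⟨a, h', rfl⟩ := hL
  exact ⟨a, h * h', gauge_mul h h' _⟩

theorem coe_gauge_mul (h : ZMod N → parabolic d) (L : ZMod N → Grp d) (n : ZMod N) :
    (gauge h L n).1 * (h n : Grp d).1 = (h (n + 1) : Grp d).1 * (L n).1 :=
  congrArg Subtype.val
    (show gauge h L n * (h n : Grp d) = h (n + 1) * L n by simp [gauge])

theorem parabolic_mulVec_single_zero (h : parabolic d) :
    (h : Grp d).1.mulVec (Pi.single 0 1) = (h : Grp d).1 0 0 • Pi.single 0 1 := by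
  ext i
  rw [Matrix.mulVec_single_one, Matrix.col_apply]
  by_cases hi : i = 0
  · simp [hi]
  · simp [hi, h.2 i hi]

theorem parabolic_apply_zero_zero_ne_zero (h : parabolic d) : (h : Grp d).1 0 0 ≠ 0 := by
  intro h₀
  refine one_ne_zero ((h : Grp d).2.symm.trans (Matrix.det_eq_zero_of_column_eq_zero 0 fun i => ?_))
  by_cases hi : i = 0
  · rw [hi, h₀]
  · exact h.2 i hi

/-- The vectors `M_n⁻¹ ⋯ M_{n+j-1}⁻¹ e₁`. The adjugate replaces the inverse, which it equals when
the determinants are `1`, because it is polynomial in the entries. -/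
def transport (M : ZMod N → Matrix (Fin (d + 1)) (Fin (d + 1)) ℝ) : ℕ → ZMod N → Fin (d + 1) → ℝ
  | 0, _ => Pi.single 0 1
  | j + 1, n => (M n).adjugate.mulVec (transport M j (n + 1))

/-- The frame formed by the first `m` transported vectors. -/
def transportFrame (M : ZMod N → Matrix (Fin (d + 1)) (Fin (d + 1)) ℝ) (n : ZMod N) :
    Matrix (Fin (d + 1)) (Fin (d + 1)) ℝ :=
  Matrix.of fun i j => transport M j n i

/-- The transported frame with its `j`-th vector, which comes from the position `n + j`, scaled
by `l (n + j)`. -/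
def scaledFrame (M : ZMod N → Matrix (Fin (d + 1)) (Fin (d + 1)) ℝ) (l : ZMod N → ℝ)
    (n : ZMod N) : Matrix (Fin (d + 1)) (Fin (d + 1)) ℝ :=
  transportFrame M n * Matrix.diagonal fun j : Fin (d + 1) => l (n + (j : ℕ))

theorem scaledFrame_col (M : ZMod N → Matrix (Fin (d + 1)) (Fin (d + 1)) ℝ) (l : ZMod N → ℝ)
    (n : ZMod N) (j : Fin (d + 1)) :
    (scaledFrame M l n).col j = l (n + (j : ℕ)) • transport M j n := by
  ext i
  rw [Matrix.col_apply, scaledFrame, Matrix.mul_diagonal, mul_comm]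
  rfl

theorem det_scaledFrame (M : ZMod N → Matrix (Fin (d + 1)) (Fin (d + 1)) ℝ) (l : ZMod N → ℝ)
    (n : ZMod N) :
    (scaledFrame M l n).det =
      (transportFrame M n).det * ∏ j ∈ Finset.range (d + 1), l (n + j) := by
  rw [scaledFrame, Matrix.det_mul, Matrix.det_diagonal,
    Fin.prod_univ_eq_prod_range (fun j : ℕ => l (n + (j : ZMod N)))]

theorem transport_gauge (h : ZMod N → parabolic d) (a : Invariants d N) (j : ℕ) (hj : j < d + 1)
    (n : ZMod N) :
    (h (n + j) : Grp d).1 0 0 • transport (fun n => (gauge h (frameSection a) n).1) j n =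
      (h n : Grp d).1.mulVec (Pi.single ⟨j, hj⟩ 1) := by
  induction j generalizing n with
  | zero =>
    rw [Nat.cast_zero, add_zero]
    exact (parabolic_mulVec_single_zero (h n)).symm
  | succ j ih =>
    set r : Fin d := ⟨j, Nat.lt_of_succ_lt_succ hj⟩
    set L := gauge h (frameSection a)
    have hstep : (h (n + 1) : Grp d).1.mulVec (Pi.single r.castSucc 1) =
        (L n).1.mulVec ((h n : Grp d).1.mulVec (Pi.single r.succ 1)) := by
      rw [← frameMatrix_mulVec_single_succ (a n), Matrix.mulVec_mulVec, Matrix.mulVec_mulVec,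
        coe_gauge_mul]
      rfl
    calc (h (n + (j + 1 : ℕ)) : Grp d).1 0 0 • transport (fun n => (L n).1) (j + 1) n
        = (L n).1.adjugate.mulVec ((h (n + 1 + j) : Grp d).1 0 0 •
            transport (fun n => (L n).1) j (n + 1)) := by
          rw [transport, Matrix.mulVec_smul, Nat.cast_succ, add_comm (j : ZMod N), add_assoc]
      _ = (L n).1.adjugate.mulVec ((h (n + 1) : Grp d).1.mulVec (Pi.single r.castSucc 1)) :=
          congrArg _ (ih (by omega) (n + 1))
      _ = (h n : Grp d).1.mulVec (Pi.single r.succ 1) := by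
          rw [hstep, Matrix.mulVec_mulVec, Matrix.adjugate_mul, (L n).2, one_smul,
            Matrix.one_mulVec]

theorem scaledFrame_gauge (h : ZMod N → parabolic d) (a : Invariants d N) (n : ZMod N) :
    scaledFrame (fun n => (gauge h (frameSection a) n).1) (fun n => (h n : Grp d).1 0 0) n =
      (h n : Grp d).1 := by
  refine Matrix.ext_col fun j => ?_
  rw [scaledFrame_col, transport_gauge h a j j.2 n, Matrix.mulVec_single_one]

theorem transportFrame_frameSection (a : Invariants d N) (n : ZMod N) :
    transportFrame (fun n => (frameSection a n).1) n = 1 := by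
  have h := scaledFrame_gauge (1 : ZMod N → parabolic d) a n
  rw [gauge_one, scaledFrame] at h
  simpa using h

theorem eq_diagonal_of_gauge_eq {h : ZMod N → parabolic d} {a a' : Invariants d N}
    (hh : gauge h (frameSection a) = frameSection a') (n : ZMod N) :
    (h n : Grp d).1 = Matrix.diagonal fun j : Fin (d + 1) => (h (n + (j : ℕ)) : Grp d).1 0 0 := by
  have := scaledFrame_gauge h a n
  rw [hh, scaledFrame, transportFrame_frameSection, one_mul] at this
  exact this.symm

/-- The condition `det h = 1` makes the products of `m` consecutive diagonal entries equal, so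
these entries are `m`-periodic as well as `N`-periodic. -/
theorem eq_smul_one_of_gauge_eq [NeZero N] (hcop : Nat.Coprime N (d + 1))
    {h : ZMod N → parabolic d} {a a' : Invariants d N}
    (hh : gauge h (frameSection a) = frameSection a') (n : ZMod N) :
    (h n : Grp d).1 = (h 0 : Grp d).1 0 0 • (1 : Matrix (Fin (d + 1)) (Fin (d + 1)) ℝ) := by
  set x : ZMod N → ℝ := fun n => (h n : Grp d).1 0 0
  have hprod (n : ZMod N) : ∏ j ∈ Finset.range (d + 1), x (n + j) = 1 := by
    have := congrArg Matrix.det (eq_diagonal_of_gauge_eq hh n)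
    rwa [(h n : Grp d).2, Matrix.det_diagonal, Fin.prod_univ_eq_prod_range
      (fun j : ℕ => x (n + (j : ZMod N))), eq_comm] at this
  have hperiod (n : ZMod N) : x (n + (d + 1 : ℕ)) = x n := by
    have := prod_range_shift_mul x n (d + 1)
    rw [hprod, hprod, one_mul, one_mul] at this
    exact this.symm
  rw [eq_diagonal_of_gauge_eq hh n, Matrix.smul_one_eq_diagonal]
  exact congrArg Matrix.diagonal
    (funext fun j => apply_eq_apply_zero_of_add_natCast hcop hperiod _)

theorem eq_of_gauge_eq [NeZero N] (hcop : Nat.Coprime N (d + 1)) {h : ZMod N → parabolic d}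
    {a a' : Invariants d N} (hh : gauge h (frameSection a) = frameSection a') : a = a' := by
  funext n
  have hmul := coe_gauge_mul h (frameSection a) n
  rw [hh, eq_smul_one_of_gauge_eq hcop hh n, eq_smul_one_of_gauge_eq hcop hh (n + 1),
    Matrix.mul_smul, mul_one, Matrix.smul_mul, one_mul] at hmul
  exact frameMatrix_injective
    (smul_right_injective _ (parabolic_apply_zero_zero_ne_zero (h 0)) hmul.symm)

theorem invariantExtension_gauge_frameSection [NeZero N] (hcop : Nat.Coprime N (d + 1))
    (f : Invariants d N → ℝ) (h : ZMod N → parabolic d) (a : Invariants d N) :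
    invariantExtension f (gauge h (frameSection a)) = f a := by
  have hmem : ∃ (a' : Invariants d N) (h' : ZMod N → parabolic d),
      gauge h' (frameSection a') = gauge h (frameSection a) := ⟨a, h, rfl⟩
  rw [invariantExtension, dif_pos hmem]
  obtain ⟨h', hh'⟩ := hmem.choose_spec
  refine congrArg f (eq_of_gauge_eq hcop (h := h⁻¹ * h') ?_)
  rw [gauge_mul, hh', gauge_inv_gauge]

theorem invariantExtension_of_notMem (f : Invariants d N → ℝ) {L : ZMod N → Grp d}
    (hL : L ∉ regularSet d N) : invariantExtension f L = 0 :=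
  dif_neg hL

theorem invariantExtension_gauge [NeZero N] (hcop : Nat.Coprime N (d + 1))
    (f : Invariants d N → ℝ) (h : ZMod N → parabolic d) (L : ZMod N → Grp d) :
    invariantExtension f (gauge h L) = invariantExtension f L := by
  by_cases hL : L ∈ regularSet d N
  · obtain ⟨a, h', rfl⟩ := hL
    rw [← gauge_mul, invariantExtension_gauge_frameSection hcop,
      invariantExtension_gauge_frameSection hcop]
  · have hL' : gauge h L ∉ regularSet d N := fun hmem =>
      hL (gauge_inv_gauge h L ▸ gauge_mem_regularSet h⁻¹ hmem)
    rw [invariantExtension_of_notMem f hL, invariantExtension_of_notMem f hL']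

end Transport

/-! ### Smooth local invariants -/

section SmoothEntries

variable {E ι : Type*} [NormedAddCommGroup E] [NormedSpace ℝ E] {x₀ : E}

/-- A matrix-valued map all of whose entries are smooth at a point. It replaces `ContDiffAt` for
matrices, which carry no global norm. -/
def SmoothEntries (A : E → Matrix ι ι ℝ) (x₀ : E) : Prop :=
  ∀ i j, ContDiffAt ℝ ∞ (fun x => A x i j) x₀

theorem smoothEntries_diagonal [DecidableEq ι] {v : E → ι → ℝ}
    (hv : ∀ i, ContDiffAt ℝ ∞ (fun x => v x i) x₀) :
    SmoothEntries (fun x => Matrix.diagonal (v x)) x₀ := by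
  intro i j
  simp only [Matrix.diagonal_apply]
  split_ifs
  · exact hv i
  · exact contDiffAt_const

variable [Fintype ι]

theorem SmoothEntries.mul {A B : E → Matrix ι ι ℝ} (hA : SmoothEntries A x₀)
    (hB : SmoothEntries B x₀) : SmoothEntries (fun x => A x * B x) x₀ := by
  intro i j
  simp only [Matrix.mul_apply]
  exact ContDiffAt.sum fun l _ => (hA i l).mul (hB l j)

theorem SmoothEntries.mulVec {A : E → Matrix ι ι ℝ} (hA : SmoothEntries A x₀) {v : E → ι → ℝ}
    (hv : ∀ i, ContDiffAt ℝ ∞ (fun x => v x i) x₀) (i : ι) :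
    ContDiffAt ℝ ∞ (fun x => (A x).mulVec (v x) i) x₀ := by
  simp only [Matrix.mulVec, dotProduct]
  exact ContDiffAt.sum fun l _ => (hA i l).mul (hv l)

variable [DecidableEq ι]

theorem SmoothEntries.det {A : E → Matrix ι ι ℝ} (hA : SmoothEntries A x₀) :
    ContDiffAt ℝ ∞ (fun x => (A x).det) x₀ := by
  simp only [Matrix.det_apply']
  exact ContDiffAt.sum fun σ _ => contDiffAt_const.mul (contDiffAt_prod fun i _ => hA _ _)

theorem SmoothEntries.adjugate {A : E → Matrix ι ι ℝ} (hA : SmoothEntries A x₀) :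
    SmoothEntries (fun x => (A x).adjugate) x₀ := by
  intro i j
  simp only [Matrix.adjugate_apply]
  refine SmoothEntries.det fun p q => ?_
  simp only [Matrix.updateRow_apply]
  split_ifs
  · exact contDiffAt_const
  · exact hA p q

end SmoothEntries

section WindowSum

variable {N k : ℕ}

/-- The sum of `k` consecutive entries of a periodic sequence. -/
def windowSum (N k : ℕ) : (ZMod N → ℝ) →ₗ[ℝ] (ZMod N → ℝ) :=
  ∑ j ∈ Finset.range k, shift (j : ℤ)

theorem windowSum_apply (k : ℕ) (x : ZMod N → ℝ) (n : ZMod N) :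
    windowSum N k x n = ∑ j ∈ Finset.range k, x (n + j) := by
  simp [windowSum, shift_apply]

theorem windowSum_injective [NeZero N] (hk : k ≠ 0) (hcop : Nat.Coprime N k) :
    Function.Injective (windowSum N k) := by
  rw [injective_iff_map_eq_zero]
  intro x hx
  have hsum (n : ZMod N) : ∑ j ∈ Finset.range k, x (n + j) = 0 := by
    rw [← windowSum_apply, hx, Pi.zero_apply]
  have hperiod (n : ZMod N) : x (n + k) = x n := by
    have := sum_range_shift_add x n k
    rw [hsum, hsum, zero_add, zero_add] at this
    exact this.symm
  have hconst := apply_eq_apply_zero_of_add_natCast hcop hperiod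
  funext n
  have h₀ := hsum n
  simp only [hconst _, Finset.sum_const, Finset.card_range, smul_eq_zero, hk, false_or] at h₀
  rw [hconst, h₀, Pi.zero_apply]

/-- `windowSum` as an automorphism of the periodic sequences, for `k` prime to the period. -/
def windowSumEquiv [NeZero N] (hk : k ≠ 0) (hcop : Nat.Coprime N k) :
    (ZMod N → ℝ) ≃ₗ[ℝ] (ZMod N → ℝ) :=
  LinearEquiv.ofInjectiveEndo (windowSum N k) (windowSum_injective hk hcop)

/-- If the products of `k` consecutive entries of `l` are the inverses of `δ₀`, then every `δ`
near `δ₀` arises in the same way from a sequence that depends smoothly on `δ`. -/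
theorem exists_contDiffAt_prod_eq_one [NeZero N] (hk : k ≠ 0) (hcop : Nat.Coprime N k)
    {l δ₀ : ZMod N → ℝ} (hl : ∀ n, δ₀ n * ∏ j ∈ Finset.range k, l (n + j) = 1) :
    ∃ Ψ : (ZMod N → ℝ) → ZMod N → ℝ, ContDiffAt ℝ ∞ Ψ δ₀ ∧
      ∀ δ : ZMod N → ℝ, (∀ n, 0 < δ₀ n / δ n) →
        ∀ n, δ n * ∏ j ∈ Finset.range k, Ψ δ (n + j) = 1 := by
  set W := windowSumEquiv hk hcop
  have hδ₀ (n : ZMod N) : δ₀ n ≠ 0 := left_ne_zero_of_mul ((hl n).trans_ne one_ne_zero)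
  refine ⟨fun δ n => l n * Real.exp (W.symm (fun i => Real.log (δ₀ i / δ i)) n), ?_,
    fun δ hδ n => ?_⟩
  · have hlog : ContDiffAt ℝ ∞ (fun (δ : ZMod N → ℝ) i => Real.log (δ₀ i / δ i)) δ₀ :=
      contDiffAt_pi.2 fun i => (contDiffAt_const.div (contDiff_apply ℝ ℝ i).contDiffAt
        (hδ₀ i)).log (div_ne_zero (hδ₀ i) (hδ₀ i))
    have hW : ContDiff ℝ ∞ W.symm := W.symm.toLinearMap.toContinuousLinearMap.contDiff
    exact contDiffAt_pi.2 fun n => contDiffAt_const.mul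
      (contDiffAt_pi.1 (hW.contDiffAt.comp δ₀ hlog) n).exp
  · have hsum : ∑ j ∈ Finset.range k, W.symm (fun i => Real.log (δ₀ i / δ i)) (n + j) =
        Real.log (δ₀ n / δ n) := by
      rw [← windowSum_apply]
      exact congrFun (W.apply_symm_apply _) n
    have hδn : δ n ≠ 0 := (div_ne_zero_iff.1 (hδ n).ne').2
    rw [Finset.prod_mul_distrib, ← Real.exp_sum, hsum, Real.exp_log (hδ n), ← hl n]
    field_simp

end WindowSum

section LocalInvariants

variable {d N : ℕ}

theorem scaledFrame_apply_zero (M : ZMod N → Matrix (Fin (d + 1)) (Fin (d + 1)) ℝ)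
    (l : ZMod N → ℝ) (n : ZMod N) {i : Fin (d + 1)} (hi : i ≠ 0) : scaledFrame M l n i 0 = 0 := by
  refine (congrFun (scaledFrame_col M l n 0) i).trans ?_
  simp [transport, hi]

theorem mul_scaledFrame_col_succ {M : ZMod N → Matrix (Fin (d + 1)) (Fin (d + 1)) ℝ}
    (l : ZMod N → ℝ) {n : ZMod N} (hM : (M n).det = 1) (r : Fin d) :
    (M n * scaledFrame M l n).col r.succ = (scaledFrame M l (n + 1)).col r.castSucc := by
  rw [← Matrix.mulVec_single_one, ← Matrix.mulVec_mulVec, Matrix.mulVec_single_one,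
    scaledFrame_col, scaledFrame_col, Matrix.mulVec_smul, Fin.val_succ, transport,
    Matrix.mulVec_mulVec, Matrix.mul_adjugate, hM, one_smul, Matrix.one_mulVec, Nat.cast_succ,
    add_comm ((r : ℕ) : ZMod N), ← add_assoc]
  rfl

/-- The gauge transform of `M` by the inverse of its scaled frame. -/
def normalForm (M : ZMod N → Matrix (Fin (d + 1)) (Fin (d + 1)) ℝ) (l : ZMod N → ℝ)
    (n : ZMod N) : Matrix (Fin (d + 1)) (Fin (d + 1)) ℝ :=
  (scaledFrame M l (n + 1)).adjugate * M n * scaledFrame M l n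

/-- The invariants that can be read off the first column of the normal form. -/
def normalInvariants (M : ZMod N → Matrix (Fin (d + 1)) (Fin (d + 1)) ℝ) (l : ZMod N → ℝ) :
    Invariants d N :=
  fun n r => (-1) ^ (d + 1) * normalForm M l n r.castSucc 0

theorem frameMatrix_normalInvariants {M : ZMod N → Matrix (Fin (d + 1)) (Fin (d + 1)) ℝ}
    {l : ZMod N → ℝ} (hM : ∀ n, (M n).det = 1) (hl : ∀ n, (scaledFrame M l n).det = 1)
    (n : ZMod N) : frameMatrix (normalInvariants M l n) = normalForm M l n := by
  refine frameMatrix_eq_of_forall_apply_succ ?_ fun i r => ?_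
  · rw [normalForm, Matrix.det_mul, Matrix.det_mul, Matrix.det_adjugate, hl, hl, hM, one_pow,
      one_mul, one_mul]
  · have hcol := congrArg ((scaledFrame M l (n + 1)).adjugate.mulVec)
      (mul_scaledFrame_col_succ l (hM n) r)
    rw [← Matrix.mulVec_single_one, ← Matrix.mulVec_single_one, Matrix.mulVec_mulVec,
      Matrix.mulVec_mulVec, Matrix.adjugate_mul, hl, one_smul, Matrix.one_mulVec,
      Matrix.mulVec_single_one, ← mul_assoc] at hcol
    exact (congrFun hcol i).trans (Pi.single_apply _ _ _)

theorem exists_gauge_frameSection_normalInvariants (L : ZMod N → Grp d) {l : ZMod N → ℝ}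
    (hl : ∀ n, (scaledFrame (fun n => (L n).1) l n).det = 1) :
    ∃ h : ZMod N → parabolic d,
      gauge h (frameSection (normalInvariants (fun n => (L n).1) l)) = L := by
  refine ⟨fun n => ⟨⟨scaledFrame (fun n => (L n).1) l n, hl n⟩,
    fun i hi => scaledFrame_apply_zero _ l n hi⟩, ?_⟩
  funext n
  rw [gauge, mul_inv_eq_iff_eq_mul]
  refine Subtype.ext ?_
  change scaledFrame _ l (n + 1) * frameMatrix _ = (L n).1 * scaledFrame _ l n
  rw [frameMatrix_normalInvariants (fun n => (L n).2) hl, normalForm, ← mul_assoc, ← mul_assoc,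
    Matrix.mul_adjugate, hl, one_smul, one_mul]

/-- `transport`, `scaledFrame` and `normalInvariants` take matrices, while smoothness on the group
is expressed in terms of entries. -/
def toMatrices (X : ZMod N → Fin (d + 1) → Fin (d + 1) → ℝ) :
    ZMod N → Matrix (Fin (d + 1)) (Fin (d + 1)) ℝ := fun n => Matrix.of (X n)

theorem toMatrices_entries (L : ZMod N → Grp d) :
    toMatrices (entries L) = fun n => (L n).1 := rfl

theorem continuous_entries : Continuous (entries : (ZMod N → Grp d) → _) :=
  continuous_pi fun n => continuous_pi fun i => continuous_pi fun j =>
    ((continuous_apply_apply i j).comp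
      (continuous_induced_dom (f := fun A : Grp d => A.1))).comp (continuous_apply n)

variable [NeZero N] (X₀ : ZMod N → Fin (d + 1) → Fin (d + 1) → ℝ)

theorem smoothEntries_toMatrices (n : ZMod N) : SmoothEntries (fun X => toMatrices X n) X₀ :=
  fun i j => ((contDiff_apply_apply ℝ ℝ i j).comp
    (contDiff_apply ℝ (Fin (d + 1) → Fin (d + 1) → ℝ) n)).contDiffAt

theorem contDiffAt_transport (j : ℕ) (n : ZMod N) (i : Fin (d + 1)) :
    ContDiffAt ℝ ∞ (fun X => transport (toMatrices X) j n i) X₀ := by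
  induction j generalizing n i with
  | zero => exact contDiffAt_const
  | succ j ih => exact (smoothEntries_toMatrices X₀ n).adjugate.mulVec (ih (n + 1)) i

theorem smoothEntries_transportFrame (n : ZMod N) :
    SmoothEntries (fun X => transportFrame (toMatrices X) n) X₀ :=
  fun i j => contDiffAt_transport X₀ j n i

variable {X₀}

theorem smoothEntries_scaledFrame {l : (ZMod N → Fin (d + 1) → Fin (d + 1) → ℝ) → ZMod N → ℝ}
    (hl : ContDiffAt ℝ ∞ l X₀) (n : ZMod N) :
    SmoothEntries (fun X => scaledFrame (toMatrices X) (l X) n) X₀ :=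
  (smoothEntries_transportFrame X₀ n).mul
    (smoothEntries_diagonal fun _ => contDiffAt_pi.1 hl _)

theorem contDiffAt_normalInvariants {l : (ZMod N → Fin (d + 1) → Fin (d + 1) → ℝ) → ZMod N → ℝ}
    (hl : ContDiffAt ℝ ∞ l X₀) :
    ContDiffAt ℝ ∞ (fun X => normalInvariants (toMatrices X) (l X)) X₀ :=
  contDiffAt_pi.2 fun n => contDiffAt_pi.2 fun _ => contDiffAt_const.mul
    ((((smoothEntries_scaledFrame hl (n + 1)).adjugate.mul (smoothEntries_toMatrices X₀ n)).mul
      (smoothEntries_scaledFrame hl n)) _ _)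

theorem exists_contDiffAt_gauge_frameSection (hcop : Nat.Coprime N (d + 1))
    {L₀ : ZMod N → Grp d} (hL₀ : L₀ ∈ regularSet d N) :
    ∃ Φ : (ZMod N → Fin (d + 1) → Fin (d + 1) → ℝ) → Invariants d N,
      ContDiffAt ℝ ∞ Φ (entries L₀) ∧
      ∀ᶠ L in 𝓝 L₀, ∃ h : ZMod N → parabolic d, gauge h (frameSection (Φ (entries L))) = L := by
  obtain ⟨a₀, h₀, hL⟩ := hL₀
  let δ : (ZMod N → Fin (d + 1) → Fin (d + 1) → ℝ) → ZMod N → ℝ :=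
    fun X n => (transportFrame (toMatrices X) n).det
  have hδ : ContDiffAt ℝ ∞ δ (entries L₀) :=
    contDiffAt_pi.2 fun n => (smoothEntries_transportFrame (entries L₀) n).det
  have hl (n : ZMod N) : δ (entries L₀) n *
      ∏ j ∈ Finset.range (d + 1), (h₀ (n + j) : Grp d).1 0 0 = 1 := by
    have := congrArg Matrix.det (scaledFrame_gauge h₀ a₀ n)
    rwa [hL, det_scaledFrame, (h₀ n : Grp d).2] at this
  obtain ⟨Ψ, hΨ, hprod⟩ := exists_contDiffAt_prod_eq_one
    (l := fun n => (h₀ n : Grp d).1 0 0) d.succ_ne_zero hcop hl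
  refine ⟨fun X => normalInvariants (toMatrices X) (Ψ (δ X)),
    contDiffAt_normalInvariants (hΨ.comp _ hδ), ?_⟩
  have hpos : ∀ᶠ L in 𝓝 L₀, ∀ n, 0 < δ (entries L₀) n / δ (entries L) n := by
    refine Filter.eventually_all.2 fun n => ?_
    have hne : δ (entries L₀) n ≠ 0 := left_ne_zero_of_mul ((hl n).trans_ne one_ne_zero)
    have hcont : ContinuousAt (fun L => δ (entries L₀) n / δ (entries L) n) L₀ :=
      continuousAt_const.div ((continuousAt_pi.1 hδ.continuousAt n).comp
        continuous_entries.continuousAt) hne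
    exact hcont.eventually_const_lt (by simp [hne])
  filter_upwards [hpos] with L hL
  rw [toMatrices_entries]
  refine exists_gauge_frameSection_normalInvariants L fun n => ?_
  rw [det_scaledFrame]
  exact hprod _ hL n

theorem isOpen_regularSet (hcop : Nat.Coprime N (d + 1)) : IsOpen (regularSet d N) := by
  refine isOpen_iff_mem_nhds.2 fun L₀ hL₀ => ?_
  obtain ⟨Φ, -, hΦ⟩ := exists_contDiffAt_gauge_frameSection hcop hL₀
  filter_upwards [hΦ] with L hL using ⟨_, hL⟩

theorem isInvariantExtension_invariantExtension (hcop : Nat.Coprime N (d + 1))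
    {f : Invariants d N → ℝ} (hf : ContDiff ℝ ∞ f) :
    IsInvariantExtension f (invariantExtension f) where
  invariant := invariantExtension_gauge hcop f
  extends_fun a := by
    rw [← gauge_one (frameSection a), invariantExtension_gauge_frameSection hcop]
  smooth L₀ hL₀ := by
    obtain ⟨Φ, hΦ, hgauge⟩ := exists_contDiffAt_gauge_frameSection hcop hL₀
    refine ⟨f ∘ Φ, hf.contDiffAt.comp _ hΦ, ?_⟩
    filter_upwards [hgauge] with L ⟨h, hh⟩
    have := invariantExtension_gauge_frameSection hcop f h (Φ (entries L))
    rwa [hh] at this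

end LocalInvariants

/-! ### Gradients -/

section MatrixCurves

variable {ι : Type*}

/-- Entrywise derivative at `0` of a curve of matrices. It replaces `HasDerivAt`, since matrices
carry no global norm. -/
def HasMatrixDeriv (A : ℝ → Matrix ι ι ℝ) (A' : Matrix ι ι ℝ) : Prop :=
  ∀ i j, HasDerivAt (fun t => A t i j) (A' i j) 0

theorem hasMatrixDeriv_const (A : Matrix ι ι ℝ) : HasMatrixDeriv (fun _ => A) 0 :=
  fun _ _ => hasDerivAt_const _ _

theorem hasMatrixDeriv_add_smul (A B : Matrix ι ι ℝ) : HasMatrixDeriv (fun t => A + t • B) B := by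
  intro i j
  simpa using ((hasDerivAt_id (0 : ℝ)).mul_const (B i j)).const_add (A i j)

variable [Fintype ι]

theorem HasMatrixDeriv.mul {A B : ℝ → Matrix ι ι ℝ} {A' B' : Matrix ι ι ℝ}
    (hA : HasMatrixDeriv A A') (hB : HasMatrixDeriv B B') :
    HasMatrixDeriv (fun t => A t * B t) (A' * B 0 + A 0 * B') := by
  intro i j
  simp only [Matrix.add_apply, Matrix.mul_apply, ← Finset.sum_add_distrib]
  exact HasDerivAt.fun_sum fun l _ => (hA i l).mul (hB l j)

open scoped Matrix.Norms.Operator in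
theorem hasMatrixDeriv_exp [DecidableEq ι] (A : Matrix ι ι ℝ) :
    HasMatrixDeriv (fun t : ℝ => NormedSpace.exp (t • A)) A := by
  intro i j
  have hexp := hasDerivAt_exp_smul_const (𝕂 := ℝ) A 0
  rw [zero_smul, NormedSpace.exp_zero, one_mul] at hexp
  exact (Matrix.entryLinearMap ℝ ℝ i j : Matrix ι ι ℝ →ₗ[ℝ] ℝ).toContinuousLinearMap.hasFDerivAt
    |>.comp_hasDerivAt (0 : ℝ) hexp

end MatrixCurves

section Exponential

variable {d : ℕ}

theorem hasMatrixDeriv_expSL (ξ : Alg d) :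
    HasMatrixDeriv (fun t : ℝ => (expSL (t • ξ)).1) ξ.1 :=
  hasMatrixDeriv_exp ξ.1

theorem expSL_zero : expSL (0 : Alg d) = 1 :=
  Subtype.ext NormedSpace.exp_zero

theorem expSL_neg (ξ : Alg d) : expSL (-ξ) = (expSL ξ)⁻¹ := by
  refine eq_inv_of_mul_eq_one_left (Subtype.ext ?_)
  change NormedSpace.exp (-ξ.1) * NormedSpace.exp ξ.1 = 1
  rw [← Matrix.exp_add_of_commute _ _ (Commute.refl ξ.1).neg_left, neg_add_cancel,
    NormedSpace.exp_zero]

theorem expSL_mem_parabolic {ξ : Alg d} (hξ : ∀ i, i ≠ 0 → ξ.1 i 0 = 0) :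
    expSL ξ ∈ parabolic d := by
  let block : Fin (d + 1) → ℕ := fun i => if i = 0 then 0 else 1
  have hblock {i j : Fin (d + 1)} : block j < block i ↔ i ≠ 0 ∧ j = 0 := by grind
  have htri : ξ.1.BlockTriangular block := fun i j hij => by
    obtain ⟨hi, rfl⟩ := hblock.1 hij
    exact hξ i hi
  exact fun i hi => htri.exp (hblock.2 ⟨hi, rfl⟩)

end Exponential

section Traceless

variable {d : ℕ}

theorem trace_coe (ξ : Alg d) : ξ.1.trace = 0 :=
  LinearMap.mem_ker.1 ξ.2

/-- The traceless part of a matrix. -/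
def traceless (M : Matrix (Fin (d + 1)) (Fin (d + 1)) ℝ) : Alg d :=
  ⟨M - (M.trace / (d + 1)) • 1, LinearMap.mem_ker.2 (by
    change (M - (M.trace / (d + 1)) • 1).trace = 0
    rw [Matrix.trace_sub, Matrix.trace_smul, Matrix.trace_one, Fintype.card_fin, smul_eq_mul,
      Nat.cast_succ, div_mul_cancel₀ _ (by positivity), sub_self])⟩

theorem coe_traceless (M : Matrix (Fin (d + 1)) (Fin (d + 1)) ℝ) :
    (traceless M).1 = M - (M.trace / (d + 1)) • 1 := rfl

theorem traceless_apply_of_ne (M : Matrix (Fin (d + 1)) (Fin (d + 1)) ℝ) {i j : Fin (d + 1)}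
    (hij : i ≠ j) : (traceless M).1 i j = M i j := by
  rw [coe_traceless, Matrix.sub_apply, Matrix.smul_apply, Matrix.one_apply_ne hij, smul_zero,
    sub_zero]

theorem trace_mul_traceless (ξ : Alg d) (M : Matrix (Fin (d + 1)) (Fin (d + 1)) ℝ) :
    (ξ.1 * (traceless M).1).trace = (ξ.1 * M).trace := by
  rw [coe_traceless, mul_sub, Matrix.trace_sub, mul_smul_comm, mul_one, Matrix.trace_smul,
    trace_coe, smul_zero, sub_zero]

theorem trace_traceless_mul (M : Matrix (Fin (d + 1)) (Fin (d + 1)) ℝ) (ξ : Alg d) :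
    ((traceless M).1 * ξ.1).trace = (M * ξ.1).trace := by
  rw [Matrix.trace_mul_comm, trace_mul_traceless, Matrix.trace_mul_comm]

theorem traceless_mul_comm (A B : Matrix (Fin (d + 1)) (Fin (d + 1)) ℝ) :
    (traceless (A * B)).1 * A = A * (traceless (B * A)).1 := by
  rw [coe_traceless, coe_traceless, Matrix.trace_mul_comm A B, sub_mul, mul_sub, smul_mul_assoc,
    one_mul, mul_smul_comm, mul_one, mul_assoc]

theorem apply_eq_zero_of_trace_mul_eq_zero {Y : Alg d}
    (hY : ∀ B : Alg d, (∀ i, i ≠ 0 → B.1 i 0 = 0) → (Y.1 * B.1).trace = 0) {i j : Fin (d + 1)}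
    (hij : ¬(i = 0 ∧ j ≠ 0)) : Y.1 i j = 0 := by
  have h := hY (traceless (Matrix.single j i 1)) fun k hk => by
    rw [traceless_apply_of_ne _ hk, Matrix.single_apply, if_neg]
    rintro ⟨rfl, rfl⟩
    exact hij ⟨rfl, hk⟩
  rwa [trace_mul_traceless, Matrix.trace_mul_single, MulOpposite.op_one, one_smul] at h

end Traceless

section Gradients

variable {d N : ℕ} [NeZero N]

theorem pairing_single (X : ZMod N → Alg d) (n : ZMod N) (ξ : Alg d) :
    pairing X (Pi.single n ξ) = ((X n).1 * ξ.1).trace := by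
  rw [pairing, Finset.sum_eq_single_of_mem n (Finset.mem_univ n) fun i _ hi => by simp [hi],
    Pi.single_eq_same]

theorem pairing_injective : Function.Injective (pairing (d := d) (N := N)) := by
  intro X X' h
  funext n
  refine Subtype.ext (Matrix.ext_iff_trace_mul_right.2 fun M => ?_)
  rw [← trace_mul_traceless (X n), ← trace_mul_traceless (X' n), ← pairing_single,
    ← pairing_single, h]

variable {F : (ZMod N → Grp d) → ℝ} {L : ZMod N → Grp d}

theorem rightGradient_eq {X : ZMod N → Alg d} (hX : IsRightGradient F L X) :
    rightGradient F L = X := by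
  have hex : ∃ X, IsRightGradient F L X := ⟨X, hX⟩
  rw [rightGradient, dif_pos hex]
  exact pairing_injective (funext fun ξ => (hex.choose_spec ξ).unique (hX ξ))

theorem leftGradient_eq {X : ZMod N → Alg d} (hX : IsLeftGradient F L X) :
    leftGradient F L = X := by
  have hex : ∃ X, IsLeftGradient F L X := ⟨X, hX⟩
  rw [leftGradient, dif_pos hex]
  exact pairing_injective (funext fun ξ => (hex.choose_spec ξ).unique (hX ξ))

/-- The derivative of `F` along every differentiable curve through `L` is obtained by pairing the
velocity with the sequence of matrices `G`. -/
def HasMatrixGradient (F : (ZMod N → Grp d) → ℝ)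
    (G : ZMod N → Matrix (Fin (d + 1)) (Fin (d + 1)) ℝ) (L : ZMod N → Grp d) : Prop :=
  ∀ (c : ℝ → ZMod N → Grp d) (δ : ZMod N → Matrix (Fin (d + 1)) (Fin (d + 1)) ℝ), c 0 = L →
    (∀ n, HasMatrixDeriv (fun t => (c t n).1) (δ n)) →
      HasDerivAt (fun t => F (c t)) (∑ n, (G n * δ n).trace) 0

omit [NeZero N] in
theorem continuousAt_of_hasMatrixDeriv {c : ℝ → ZMod N → Grp d}
    {δ : ZMod N → Matrix (Fin (d + 1)) (Fin (d + 1)) ℝ}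
    (hc : ∀ n, HasMatrixDeriv (fun t => (c t n).1) (δ n)) : ContinuousAt c 0 := by
  refine continuousAt_pi.2 fun n => ?_
  refine (Topology.IsInducing.continuousAt_iff (g := fun A : Grp d => A.1) ⟨rfl⟩).2 ?_
  exact continuousAt_pi.2 fun i => continuousAt_pi.2 fun j => (hc n i j).continuousAt

theorem apply_eq_sum_trace (φ : (ZMod N → Fin (d + 1) → Fin (d + 1) → ℝ) →L[ℝ] ℝ)
    (δ : ZMod N → Matrix (Fin (d + 1)) (Fin (d + 1)) ℝ) :
    φ (fun n i j => δ n i j) = ∑ n, (Matrix.of (fun i j =>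
      φ (Pi.single n (Pi.single j (Pi.single i 1)))) * δ n).trace := by
  have hδ : (fun n i j => δ n i j : ZMod N → Fin (d + 1) → Fin (d + 1) → ℝ) =
      ∑ n, ∑ i, ∑ j, δ n i j • Pi.single n (Pi.single i (Pi.single j (1 : ℝ))) := by
    funext n i j
    simp [Finset.sum_apply, Pi.single_apply, apply_ite, ite_apply]
  rw [hδ]
  simp only [map_sum, map_smul, smul_eq_mul, Matrix.trace, Matrix.diag_apply, Matrix.mul_apply,
    Matrix.of_apply]
  refine Finset.sum_congr rfl fun n _ => ?_
  rw [Finset.sum_comm]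
  exact Finset.sum_congr rfl fun i _ => Finset.sum_congr rfl fun j _ => mul_comm _ _

theorem SmoothAt.exists_hasMatrixGradient (hF : SmoothAt F L) : ∃ G, HasMatrixGradient F G L := by
  obtain ⟨Φ, hΦ, hFΦ⟩ := hF
  refine ⟨fun n => Matrix.of fun i j =>
    fderiv ℝ Φ (entries L) (Pi.single n (Pi.single j (Pi.single i 1))), fun c δ hc hδ => ?_⟩
  subst hc
  have hentries : HasDerivAt (fun t => entries (c t)) (fun n i j => δ n i j) 0 :=
    hasDerivAt_pi.2 fun n => hasDerivAt_pi.2 fun i => hasDerivAt_pi.2 fun j => hδ n i j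
  have hcomp := (hΦ.differentiableAt (by simp)).hasFDerivAt.comp_hasDerivAt (0 : ℝ) hentries
  rw [← apply_eq_sum_trace]
  exact hcomp.congr_of_eventuallyEq ((continuousAt_of_hasMatrixDeriv hδ).eventually hFΦ)

namespace HasMatrixGradient

variable {G : ZMod N → Matrix (Fin (d + 1)) (Fin (d + 1)) ℝ}

theorem rightGradient_eq (hG : HasMatrixGradient F G L) :
    rightGradient F L = fun n => traceless (G n * (L n).1) := by
  refine TwistedPolygon.rightGradient_eq fun ξ => ?_
  have hderiv (n : ZMod N) : HasMatrixDeriv (fun t : ℝ => (L n * expSL (t • ξ n)).1)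
      ((L n).1 * (ξ n).1) := by
    simpa only [zero_mul, zero_add, Matrix.SpecialLinearGroup.coe_mul] using
      (hasMatrixDeriv_const (L n).1).mul (hasMatrixDeriv_expSL (ξ n))
  refine (hG _ _ ?_ hderiv).congr_deriv (Finset.sum_congr rfl fun n _ => ?_)
  · simp only [zero_smul, expSL_zero, mul_one]
  · rw [trace_traceless_mul, mul_assoc]

theorem leftGradient_eq (hG : HasMatrixGradient F G L) :
    leftGradient F L = fun n => traceless ((L n).1 * G n) := by
  refine TwistedPolygon.leftGradient_eq fun ξ => ?_
  have hderiv (n : ZMod N) : HasMatrixDeriv (fun t : ℝ => (expSL (t • ξ n) * L n).1)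
      ((ξ n).1 * (L n).1) := by
    simpa only [mul_zero, add_zero, Matrix.SpecialLinearGroup.coe_mul] using
      (hasMatrixDeriv_expSL (ξ n)).mul (hasMatrixDeriv_const (L n).1)
  refine (hG _ _ ?_ hderiv).congr_deriv (Finset.sum_congr rfl fun n _ => ?_)
  · simp only [zero_smul, expSL_zero, one_mul]
  · rw [trace_traceless_mul, ← mul_assoc, Matrix.trace_mul_cycle]

theorem sum_trace_gauge_eq_zero (hG : HasMatrixGradient F G L)
    (hF : ∀ (h : ZMod N → parabolic d) (L : ZMod N → Grp d), F (gauge h L) = F L)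
    {η : ZMod N → Alg d} (hη : ∀ n i, i ≠ 0 → (η n).1 i 0 = 0) :
    ∑ n, (G n * ((η (n + 1)).1 * (L n).1 - (L n).1 * (η n).1)).trace = 0 := by
  let h (t : ℝ) (n : ZMod N) : parabolic d := ⟨expSL (t • η n), expSL_mem_parabolic fun i hi => by
    change t * (η n).1 i 0 = 0
    rw [hη n i hi, mul_zero]⟩
  have hgauge (t : ℝ) (n : ZMod N) :
      (gauge (h t) L n).1 = (expSL (t • η (n + 1))).1 * (L n).1 * (expSL (t • -η n)).1 := by
    rw [smul_neg, expSL_neg]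
    rfl
  have hderiv (n : ZMod N) : HasMatrixDeriv (fun t => (gauge (h t) L n).1)
      ((η (n + 1)).1 * (L n).1 - (L n).1 * (η n).1) := by
    have := ((hasMatrixDeriv_expSL (η (n + 1))).mul (hasMatrixDeriv_const (L n).1)).mul
      (hasMatrixDeriv_expSL (-η n))
    simp only [zero_smul, expSL_zero, Matrix.SpecialLinearGroup.coe_one, mul_zero, add_zero,
      mul_one, one_mul, ← hgauge] at this
    rwa [sub_eq_add_neg, ← mul_neg]
  have hzero : gauge (h 0) L = L := by
    funext n
    simp [gauge, h, expSL_zero]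
  have hd := hG (fun t => gauge (h t) L) _ hzero hderiv
  simp only [hF] at hd
  exact hd.unique (hasDerivAt_const _ _)

theorem leftGradient_apply_eq_rightGradient_apply (hG : HasMatrixGradient F G L)
    (hF : ∀ (h : ZMod N → parabolic d) (L : ZMod N → Grp d), F (gauge h L) = F L) (n : ZMod N)
    {i j : Fin (d + 1)} (hij : ¬(i = 0 ∧ j ≠ 0)) :
    (leftGradient F L n).1 i j = (rightGradient F L (n + 1)).1 i j := by
  refine sub_eq_zero.1 (apply_eq_zero_of_trace_mul_eq_zero
    (Y := leftGradient F L n - rightGradient F L (n + 1)) (fun B hB => ?_) hij)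
  have hsum := hG.sum_trace_gauge_eq_zero hF (η := Pi.single (n + 1) B) fun k i hi => by
    obtain rfl | hk := eq_or_ne k (n + 1)
    · simpa using hB i hi
    · simp [hk]
  have hterm (k : ZMod N) (β γ : Alg d) : (G k * (β.1 * (L k).1 - (L k).1 * γ.1)).trace =
      ((leftGradient F L k).1 * β.1).trace - ((rightGradient F L k).1 * γ.1).trace := by
    rw [hG.leftGradient_eq, hG.rightGradient_eq, trace_traceless_mul, trace_traceless_mul, mul_sub,
      Matrix.trace_sub, ← mul_assoc, Matrix.trace_mul_cycle, ← mul_assoc]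
  simp only [hterm, Finset.sum_sub_distrib] at hsum
  rw [Finset.sum_eq_single_of_mem n (Finset.mem_univ n) fun k _ hk => by simp [hk],
    Finset.sum_eq_single_of_mem (n + 1) (Finset.mem_univ _) fun k _ hk => by simp [hk]] at hsum
  simpa [sub_mul] using hsum

end HasMatrixGradient

end Gradients

section SectionGradients

variable {d N : ℕ}

theorem mul_frameMatrix_apply_succ (M : Matrix (Fin (d + 1)) (Fin (d + 1)) ℝ) (a : Fin d → ℝ)
    (i : Fin (d + 1)) (r : Fin d) : (M * frameMatrix a) i r.succ = M i r.castSucc := by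
  simp [Matrix.mul_apply, frameMatrix_succ]

theorem frameMatrix_add_smul_single (a : Fin d → ℝ) (r : Fin d) (t : ℝ) :
    frameMatrix (a + t • Pi.single r 1) =
      frameMatrix a + t • Matrix.single r.castSucc 0 ((-1) ^ (d + 1)) := by
  ext i j
  cases j using Fin.cases with
  | succ s => simp [frameMatrix_succ, (Fin.succ_ne_zero s).symm]
  | zero =>
    cases i using Fin.lastCases with
    | last => simp [frameMatrix_last_zero, (Fin.castSucc_lt_last r).ne]
    | cast s =>
      obtain rfl | hs := eq_or_ne s r
      · simp [frameMatrix_castSucc_zero]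
        ring
      · simp [frameMatrix_castSucc_zero, hs, hs.symm]

variable [NeZero N]

theorem HasMatrixGradient.rightGradient_apply_zero_succ {F : (ZMod N → Grp d) → ℝ}
    {f : Invariants d N → ℝ} {a : Invariants d N}
    {G : ZMod N → Matrix (Fin (d + 1)) (Fin (d + 1)) ℝ}
    (hG : HasMatrixGradient F G (frameSection a)) (hF : ∀ a, F (frameSection a) = f a)
    (hf : DifferentiableAt ℝ f a) (n : ZMod N) (r : Fin d) :
    (rightGradient F (frameSection a) n).1 0 r.succ =
      (-1) ^ (d + 1) * fderiv ℝ f a (Pi.single n (Pi.single r 1)) := by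
  set b : Invariants d N := Pi.single n (Pi.single r 1) with hb
  have hcurve (k : ZMod N) : HasMatrixDeriv (fun t : ℝ => (frameSection (a + t • b) k).1)
      ((Pi.single n (Matrix.single r.castSucc 0 ((-1) ^ (d + 1))) : ZMod N → Matrix _ _ ℝ) k) := by
    change HasMatrixDeriv (fun t : ℝ => frameMatrix (a k + t • b k)) _
    obtain rfl | hk := eq_or_ne k n
    · simp only [hb, Pi.single_eq_same, frameMatrix_add_smul_single]
      exact hasMatrixDeriv_add_smul _ _
    · simp only [hb, Pi.single_eq_of_ne hk, smul_zero, add_zero]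
      exact hasMatrixDeriv_const _
  have hd := hG _ _ (by simp) hcurve
  simp only [hF] at hd
  have heq : ((-1) ^ (d + 1)) * G n 0 r.castSucc = fderiv ℝ f a b := by
    rw [← hd.unique (hf.hasFDerivAt.hasLineDerivAt b),
      Finset.sum_eq_single_of_mem n (Finset.mem_univ n) fun k _ hk => by simp [hk],
      Pi.single_eq_same, Matrix.trace_mul_single, op_smul_eq_smul, smul_eq_mul]
  rw [hG.rightGradient_eq, traceless_apply_of_ne _ (Fin.succ_ne_zero r).symm, ← heq, ← mul_assoc,
    neg_one_pow_mul_self, one_mul]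
  exact mul_frameMatrix_apply_succ _ _ _ _

/-- The relations between the right gradient `Q` and the left gradient `P`, at the point of the
section with invariants `a`, of the invariant extension of a function with differential `ξ`. -/
structure IsGradientPair (a : Invariants d N) (ξ : Invariants d N →L[ℝ] ℝ)
    (Q P : ZMod N → Matrix (Fin (d + 1)) (Fin (d + 1)) ℝ) : Prop where
  mul_eq : ∀ n, P n * frameMatrix (a n) = frameMatrix (a n) * Q n
  apply_eq : ∀ n i j, ¬(i = 0 ∧ j ≠ 0) → P n i j = Q (n + 1) i j
  first_row : ∀ n r, Q n 0 r.succ = (-1) ^ (d + 1) * ξ (Pi.single n (Pi.single r 1))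

theorem isGradientPair (hcop : Nat.Coprime N (d + 1)) {f : Invariants d N → ℝ}
    (hf : ContDiff ℝ ∞ f) (a : Invariants d N) :
    IsGradientPair a (fderiv ℝ f a)
      (fun n => (rightGradient (invariantExtension f) (frameSection a) n).1)
      (fun n => (leftGradient (invariantExtension f) (frameSection a) n).1) := by
  have hF := isInvariantExtension_invariantExtension hcop hf
  obtain ⟨G, hG⟩ := (hF.smooth (frameSection a) ⟨a, 1, gauge_one _⟩).exists_hasMatrixGradient
  refine ⟨fun n => ?_, fun n i j hij => ?_, fun n r => ?_⟩
  · rw [hG.leftGradient_eq, hG.rightGradient_eq]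
    exact traceless_mul_comm _ _
  · exact hG.leftGradient_apply_eq_rightGradient_apply hF.invariant n hij
  · exact hG.rightGradient_apply_zero_succ hF.extends_fun (hf.differentiable (by simp) a) n r

end SectionGradients

section FirstColumn

open DiffOp

variable {d N : ℕ}

theorem frameMatrix_mul_apply_castSucc (M : Matrix (Fin (d + 1)) (Fin (d + 1)) ℝ) (a : Fin d → ℝ)
    (r : Fin d) (j : Fin (d + 1)) :
    (frameMatrix a * M) r.castSucc j = (-1) ^ (d + 1) * a r * M 0 j + M r.succ j := by
  simp [Matrix.mul_apply, Fin.sum_univ_succ, frameMatrix_castSucc_zero, frameMatrix_succ]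

theorem frameMatrix_mul_apply_last (M : Matrix (Fin (d + 1)) (Fin (d + 1)) ℝ) (a : Fin d → ℝ)
    (j : Fin (d + 1)) : (frameMatrix a * M) (Fin.last d) j = (-1) ^ d * M 0 j := by
  simp [Matrix.mul_apply, Fin.sum_univ_succ, frameMatrix_last_zero, frameMatrix_succ,
    (Fin.castSucc_lt_last _).ne']

/-- The entries of a matrix, extended by zero to all natural indices. -/
def natEntry (M : Matrix (Fin (d + 1)) (Fin (d + 1)) ℝ) (i j : ℕ) : ℝ :=
  if h : i < d + 1 ∧ j < d + 1 then M ⟨i, h.1⟩ ⟨j, h.2⟩ else 0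

theorem natEntry_val (M : Matrix (Fin (d + 1)) (Fin (d + 1)) ℝ) (i j : Fin (d + 1)) :
    natEntry M i j = M i j :=
  dif_pos ⟨i.2, j.2⟩

theorem natEntry_of_lt (M : Matrix (Fin (d + 1)) (Fin (d + 1)) ℝ) {i : ℕ} (j : ℕ) (hi : d < i) :
    natEntry M i j = 0 :=
  dif_neg (by omega)

/-- The components of a covector, extended by zero to all natural indices. -/
def component (ξ : Invariants d N →L[ℝ] ℝ) (p : ℕ) (n : ZMod N) : ℝ :=
  if h : p < d then ξ (Pi.single n (Pi.single ⟨p, h⟩ 1)) else 0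

theorem component_val (ξ : Invariants d N →L[ℝ] ℝ) (r : Fin d) (n : ZMod N) :
    component ξ r n = ξ (Pi.single n (Pi.single r 1)) :=
  dif_pos r.2

theorem coeff_covectorOp_mul (ξ : Invariants d N →L[ℝ] ℝ) (x : DiffOp N) (k : ℤ) (n : ZMod N) :
    coeff k (covectorOp ξ * x) n = ∑ p ∈ Finset.range d,
      component ξ p (n - (p + 1)) * coeff (k + p + 1) x (n - (p + 1)) := by
  rw [covectorOp_apply, Finset.sum_mul, map_sum, Finset.sum_apply, Finset.sum_range]
  refine Finset.sum_congr rfl fun p _ => ?_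
  rw [coeff_monomial_mul, Pi.mul_apply, shift_apply, shift_apply, component_val]
  have hn : n + ((-((p : ℤ) + 1) : ℤ) : ZMod N) = n - ((p : ℕ) + 1) := by
    push_cast
    ring
  rw [hn, sub_neg_eq_add, add_assoc k]

theorem coeff_laxOp_fin (e : ℝ) (a : Invariants d N) (r : Fin d) :
    coeff (r + 1) (laxOp e a) = fun n => -a n r := by
  rw [coeff_laxOp, coeff_invariantsOp_fin, if_neg (by omega), if_neg (by omega), smul_zero,
    add_zero, zero_add]

namespace IsGradientPair

variable {a : Invariants d N} {ξ : Invariants d N →L[ℝ] ℝ}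
  {Q P : ZMod N → Matrix (Fin (d + 1)) (Fin (d + 1)) ℝ}

theorem right_apply_castSucc (h : IsGradientPair a ξ Q P) (n : ZMod N) (r s : Fin d)
    (hr : r.castSucc ≠ 0) : Q (n + 1) r.castSucc s.castSucc =
      a n r * ξ (Pi.single n (Pi.single s 1)) + Q n r.succ s.succ := by
  rw [← h.apply_eq n _ _ fun hc => hr hc.1, ← mul_frameMatrix_apply_succ (P n) (a n), h.mul_eq,
    frameMatrix_mul_apply_castSucc, h.first_row]
  linear_combination a n r * ξ (Pi.single n (Pi.single s 1)) * neg_one_pow_mul_self (d + 1)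

theorem right_apply_last (h : IsGradientPair a ξ Q P) (n : ZMod N) (s : Fin d) :
    Q (n + 1) (Fin.last d) s.castSucc = -ξ (Pi.single n (Pi.single s 1)) := by
  have hd : Fin.last d ≠ 0 := ((Fin.zero_le _).trans_lt (Fin.castSucc_lt_last s)).ne'
  rw [← h.apply_eq n _ _ fun hc => hd hc.1, ← mul_frameMatrix_apply_succ (P n) (a n), h.mul_eq,
    frameMatrix_mul_apply_last, h.first_row, pow_succ]
  linear_combination -ξ (Pi.single n (Pi.single s 1)) * neg_one_pow_mul_self d

theorem natEntry_add_one (h : IsGradientPair a ξ Q P) (e : ℝ) (n : ZMod N) {i j : ℕ}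
    (hji : j < i) : natEntry (Q (n + 1)) i j =
      natEntry (Q n) (i + 1) (j + 1) - component ξ j n * coeff (i + 1) (laxOp e a) n := by
  obtain hi | rfl | hi := lt_trichotomy i d
  · lift i to Fin d using hi
    lift j to Fin d using hji.trans i.2
    have hi : i.castSucc ≠ 0 := ((Fin.zero_le _).trans_lt (Fin.castSucc_lt_castSucc_iff.2 hji)).ne'
    have hstep : natEntry (Q (n + 1)) i j = _ :=
      (natEntry_val _ i.castSucc j.castSucc).trans (h.right_apply_castSucc n i j hi)
    rw [hstep, ← natEntry_val (Q n), component_val, coeff_laxOp_fin, Fin.val_succ, Fin.val_succ]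
    ring
  · lift j to Fin i using hji
    have hlast : natEntry (Q (n + 1)) i j = _ :=
      (natEntry_val _ (Fin.last i) j.castSucc).trans (h.right_apply_last n j)
    rw [hlast, component_val, coeff_laxOp_top, natEntry_of_lt _ _ i.lt_succ_self, Pi.one_apply]
    ring
  · rw [natEntry_of_lt _ _ hi, natEntry_of_lt _ _ (hi.trans i.lt_succ_self),
      coeff_laxOp_of_gt e a (by omega), Pi.zero_apply, mul_zero, sub_zero]

theorem natEntry_eq_sub_sum (h : IsGradientPair a ξ Q P) (e : ℝ) (n : ZMod N) {i j : ℕ}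
    (hji : j < i) (p : ℕ) : natEntry (Q n) i j = natEntry (Q (n - p)) (i + p) (j + p) -
      ∑ q ∈ Finset.range p,
        component ξ (j + q) (n - (q + 1)) * coeff (i + q + 1) (laxOp e a) (n - (q + 1)) := by
  induction p with
  | zero => simp
  | succ p ih =>
    have hstep := h.natEntry_add_one e (n - (p + 1)) (Nat.add_lt_add_right hji p)
    rw [show n - (p + 1) + 1 = n - p by ring] at hstep
    rw [ih, hstep, Finset.sum_range_succ, Nat.cast_add i, Nat.cast_succ, add_assoc i, add_assoc j]
    ring

theorem coeff_covectorOp_mul_laxOp (h : IsGradientPair a ξ Q P) (e : ℝ) (r : Fin d) (n : ZMod N) :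
    coeff (r + 1) (covectorOp ξ * laxOp e a) n = -Q n r.succ 0 := by
  rw [coeff_covectorOp_mul, ← natEntry_val (Q n), Fin.val_succ, Fin.val_zero,
    h.natEntry_eq_sub_sum e n r.1.succ_pos d, natEntry_of_lt _ _ (by lia), zero_sub, neg_neg]
  simp only [zero_add, Nat.cast_succ]

end IsGradientPair

end FirstColumn

section Brackets

variable {d : ℕ}

theorem trace_gradeNegOne_mul_gradeOne (X Y : Alg d) :
    (gradeNegOne X * gradeOne Y).trace = ∑ r : Fin d, X.1 r.succ 0 * Y.1 0 r.succ := by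
  simp [Matrix.trace, Matrix.mul_apply, gradeNegOne, gradeOne, Fin.sum_univ_succ, Fin.succ_ne_zero]

theorem rTensor_eq_sum (X Y : Alg d) :
    rTensor X Y = ∑ i, ∑ j, if j < i then X.1 i j * Y.1 j i else 0 := by
  simp only [rTensor, Matrix.trace, Matrix.diag_apply, Matrix.mul_apply, upper, lower,
    Matrix.of_apply, ite_mul, mul_ite, zero_mul, mul_zero, ← ite_and, and_self]

theorem rWedge_eq_sum (X Y : Alg d) : rWedge X Y = (1 / 2) * ∑ i, ∑ j,
    if j < i then X.1 i j * Y.1 j i - X.1 j i * Y.1 i j else 0 := by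
  have hsub : rWedge X Y = (1 / 2) * ((∑ i, ∑ j, if j < i then X.1 i j * Y.1 j i else 0)
      - ∑ i, ∑ j, if i < j then X.1 i j * Y.1 j i else 0) := by
    rw [rWedge, rMatrix, Matrix.mul_smul, Matrix.trace_smul, smul_eq_mul, mul_sub X.1,
      Matrix.trace_sub]
    simp only [Matrix.trace, Matrix.diag_apply, Matrix.mul_apply, upper, lower, Matrix.of_apply,
      mul_ite, mul_zero]
  rw [hsub, Finset.sum_comm (f := fun i j => if i < j then X.1 i j * Y.1 j i else 0)]
  simp only [← Finset.sum_sub_distrib, ite_sub_ite, sub_zero]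

theorem rWedge_add_rWedge_sub_rTensor_add_rTensor {X Y X' Y' : Alg d}
    (h : ∀ i j, ¬(i = 0 ∧ j ≠ 0) → X.1 i j = Y.1 i j)
    (h' : ∀ i j, ¬(i = 0 ∧ j ≠ 0) → X'.1 i j = Y'.1 i j) :
    rWedge X X' + rWedge Y Y' - rTensor Y X' + rTensor Y' X =
      (1 / 2) * ((Y'.1 * (X.1 - Y.1)).trace - (Y.1 * (X'.1 - Y'.1)).trace) := by
  simp only [rWedge_eq_sum, rTensor_eq_sum, Matrix.trace, Matrix.diag_apply, Matrix.mul_apply,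
    Matrix.sub_apply, Finset.mul_sum, mul_sub, ← Finset.sum_add_distrib,
    ← Finset.sum_sub_distrib]
  refine Finset.sum_congr rfl fun i _ => Finset.sum_congr rfl fun j _ => ?_
  by_cases hij : j < i
  · have hi : i ≠ 0 := ((Fin.zero_le j).trans_lt hij).ne'
    simp only [if_pos hij, h i j fun hc => hi hc.1, h' i j fun hc => hi hc.1]
    ring
  · have hji : ¬(j = 0 ∧ i ≠ 0) := fun hc => hij (hc.1 ▸ Fin.pos_of_ne_zero hc.2)
    simp only [if_neg hij, h j i hji, h' j i hji]
    ring

end Brackets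

/-! ### The action of difference operators on sequences of vectors -/

section Representation

open DiffOp

variable {d N : ℕ}

/-- Periodic sequences of vectors in `ℝᵐ`, `m = d + 1`. -/
abbrev VecSeq (d N : ℕ) : Type := ZMod N → Fin (d + 1) → ℝ

/-- The twisted shift `(T w)ₙ = Lₙ⁻¹ wₙ₊₁`. -/
def twistedShift (L : ZMod N → Grp d) : (Module.End ℝ (VecSeq d N))ˣ where
  val := LinearMap.pi fun n => (L n)⁻¹.1.mulVecLin ∘ₗ LinearMap.proj (n + 1)
  inv := LinearMap.pi fun n => (L (n - 1)).1.mulVecLin ∘ₗ LinearMap.proj (n - 1)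
  val_inv := by
    refine LinearMap.ext fun w => funext fun n => ?_
    change (L n)⁻¹.1.mulVec ((L (n + 1 - 1)).1.mulVec (w (n + 1 - 1))) = w n
    rw [add_sub_cancel_right, Matrix.mulVec_mulVec, ← Matrix.SpecialLinearGroup.coe_mul,
      inv_mul_cancel, Matrix.SpecialLinearGroup.coe_one, Matrix.one_mulVec]
  inv_val := by
    refine LinearMap.ext fun w => funext fun n => ?_
    change (L (n - 1)).1.mulVec ((L (n - 1))⁻¹.1.mulVec (w (n - 1 + 1))) = w n
    rw [sub_add_cancel, Matrix.mulVec_mulVec, ← Matrix.SpecialLinearGroup.coe_mul,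
      mul_inv_cancel, Matrix.SpecialLinearGroup.coe_one, Matrix.one_mulVec]

/-- Multiplication of vector sequences by scalar sequences. -/
def scalarMul : (ZMod N → ℝ) →+* Module.End ℝ (VecSeq d N) :=
  Module.toModuleEnd ℝ (VecSeq d N)

theorem scalarMul_shift_one_mul (L : ZMod N → Grp d) (x : ZMod N → ℝ) :
    scalarMul (shift 1 x) * (twistedShift L).val = (twistedShift L).val * scalarMul x := by
  refine LinearMap.ext fun w => funext fun n => ?_
  change x (n + ((1 : ℤ) : ZMod N)) • (L n)⁻¹.1.mulVec (w (n + 1)) =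
    (L n)⁻¹.1.mulVec (x (n + 1) • w (n + 1))
  rw [Int.cast_one, Matrix.mulVec_smul]

theorem scalarMul_shift_neg_one_mul (L : ZMod N → Grp d) (x : ZMod N → ℝ) :
    scalarMul (shift (-1) x) * (twistedShift L)⁻¹.val = (twistedShift L)⁻¹.val * scalarMul x := by
  rw [Units.mul_inv_eq_iff_eq_mul, mul_assoc, ← Units.inv_mul_eq_iff_eq_mul, inv_inv,
    ← scalarMul_shift_one_mul, shift_shift, add_neg_cancel, shift_zero]

theorem scalarMul_shift_mul (L : ZMod N → Grp d) (k : ℤ) (x : ZMod N → ℝ) :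
    scalarMul (shift k x) * (twistedShift L ^ k).val = (twistedShift L ^ k).val * scalarMul x := by
  induction k generalizing x with
  | zero => simp [shift_zero]
  | succ k ih =>
    rw [zpow_add_one, Units.val_mul, ← mul_assoc, ← shift_shift, ih, mul_assoc,
      scalarMul_shift_one_mul, mul_assoc]
  | pred k ih =>
    rw [zpow_sub_one, Units.val_mul, ← mul_assoc, sub_eq_add_neg, ← shift_shift, ih, mul_assoc,
      scalarMul_shift_neg_one_mul, mul_assoc]

/-- The action of difference operators on vector sequences in which `T` is the twisted shift. -/
def opAction (L : ZMod N → Grp d) : DiffOp N →+* Module.End ℝ (VecSeq d N) :=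
  SkewMonoidAlgebra.liftNCRingHom scalarMul
    ((Units.coeHom _).comp (zpowersHom _ (twistedShift L)))
    fun {x g} => scalarMul_shift_mul L g.toAdd x

theorem opAction_monomial (L : ZMod N → Grp d) (k : ℤ) (x : ZMod N → ℝ) :
    opAction L (monomial k x) = scalarMul x * (twistedShift L ^ k).val :=
  SkewMonoidAlgebra.liftNC_single _ _ _ _

theorem opAction_monomial_apply (L : ZMod N → Grp d) (k : ℤ) (x : ZMod N → ℝ) (w : VecSeq d N)
    (n : ZMod N) : opAction L (monomial k x) w n = x n • opAction L (monomial k 1) w n := by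
  rw [opAction_monomial, opAction_monomial, map_one, one_mul]
  rfl

theorem opAction_monomial_zero_one (L : ZMod N → Grp d) (w : VecSeq d N) :
    opAction L (monomial 0 1) w = w := by
  rw [monomial_zero_one, map_one, Module.End.one_apply]

theorem opAction_monomial_add_one (L : ZMod N → Grp d) (k : ℤ) (w : VecSeq d N) (n : ZMod N) :
    opAction L (monomial (k + 1) 1) w n =
      (L n)⁻¹.1.mulVec (opAction L (monomial k 1) w (n + 1)) := by
  rw [opAction_monomial, opAction_monomial, map_one, one_mul, one_mul, add_comm k, zpow_one_add,
    Units.val_mul]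
  rfl

theorem opAction_invariantsOp (L : ZMod N → Grp d) (v : Invariants d N) (w : VecSeq d N)
    (n : ZMod N) : opAction L (invariantsOp v) w n =
      -∑ r : Fin d, v n r • opAction L (monomial (r + 1) 1) w n := by
  have hop : invariantsOp v = -∑ r : Fin d, monomial (r + 1) fun n => v n r := by
    simp only [invariantsOp, LinearMap.neg_apply, LinearMap.sum_apply]
    rfl
  rw [hop, map_neg, map_sum, LinearMap.neg_apply, LinearMap.sum_apply, Pi.neg_apply,
    Finset.sum_apply]
  exact congrArg Neg.neg (Finset.sum_congr rfl fun r _ => opAction_monomial_apply L _ _ w n)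

theorem opAction_laxOp (L : ZMod N → Grp d) (e : ℝ) (a : Invariants d N) (w : VecSeq d N)
    (n : ZMod N) : opAction L (laxOp e a) w n = opAction L (monomial (d + 1) 1) w n + e • w n
      - ∑ r : Fin d, a n r • opAction L (monomial (r + 1) 1) w n := by
  have hconst : e • (1 : DiffOp N) = monomial 0 fun _ => e := by
    rw [← monomial_zero_one, ← map_smul]
    exact congrArg _ (funext fun _ => mul_one e)
  rw [laxOp, map_add, map_add, hconst, LinearMap.add_apply, LinearMap.add_apply, Pi.add_apply,
    Pi.add_apply, opAction_invariantsOp, opAction_monomial_apply L 0, opAction_monomial_zero_one,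
    sub_eq_add_neg]

/-- The constant sequence of the first basis vector, from which `T` generates all of them. -/
def cyclicVector (d N : ℕ) : VecSeq d N := fun _ => Pi.single 0 1

variable (a : Invariants d N)

theorem inv_frameSection_mul_frameMatrix (n : ZMod N) :
    (frameSection a n)⁻¹.1 * frameMatrix (a n) = 1 :=
  congrArg Subtype.val (inv_mul_cancel (frameSection a n))

theorem frameMatrix_mul_inv_frameSection (n : ZMod N) :
    frameMatrix (a n) * (frameSection a n)⁻¹.1 = 1 :=
  congrArg Subtype.val (mul_inv_cancel (frameSection a n))

theorem opAction_monomial_cyclicVector (j : Fin (d + 1)) (n : ZMod N) :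
    opAction (frameSection a) (monomial j 1) (cyclicVector d N) n = Pi.single j 1 := by
  induction j using Fin.induction generalizing n with
  | zero => rw [Fin.val_zero, Nat.cast_zero, opAction_monomial_zero_one, cyclicVector]
  | succ r ih =>
    rw [Fin.val_succ, Nat.cast_succ, opAction_monomial_add_one, ← Fin.val_castSucc, ih,
      ← frameMatrix_mulVec_single_succ (a n), Matrix.mulVec_mulVec,
      inv_frameSection_mul_frameMatrix, Matrix.one_mulVec]

theorem neg_one_pow_smul_opAction_laxOp (L : ZMod N → Grp d) (w : VecSeq d N) (n : ZMod N) :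
    (-1 : ℝ) ^ (d + 1) • opAction L (laxOp ((-1) ^ (d + 1)) a) w n =
      w n - ∑ j, frameMatrix (a n) j 0 • opAction L (monomial (j + 1) 1) w n := by
  rw [opAction_laxOp, Fin.sum_univ_castSucc, frameMatrix_last_zero, smul_sub, smul_add, smul_smul,
    neg_one_pow_mul_self, one_smul, Finset.smul_sum]
  simp only [frameMatrix_castSucc_zero, smul_smul, Fin.val_castSucc, Fin.val_last]
  rw [pow_succ]
  module

theorem opAction_laxOp_cyclicVector :
    opAction (frameSection a) (laxOp ((-1) ^ (d + 1)) a) (cyclicVector d N) = 0 := by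
  funext n
  have hsum : ∑ j, frameMatrix (a n) j 0 •
      opAction (frameSection a) (monomial (j + 1) 1) (cyclicVector d N) n =
        (frameSection a n)⁻¹.1.mulVec ((frameMatrix (a n)).mulVec (Pi.single 0 1)) := by
    rw [Matrix.mulVec_single_one, Matrix.mulVec_eq_sum]
    refine Finset.sum_congr rfl fun j _ => ?_
    rw [opAction_monomial_add_one, opAction_monomial_cyclicVector, Matrix.mulVec_single_one,
      op_smul_eq_smul]
    rfl
  have h := neg_one_pow_smul_opAction_laxOp a (frameSection a) (cyclicVector d N) n
  rw [hsum, Matrix.mulVec_mulVec, inv_frameSection_mul_frameMatrix, Matrix.one_mulVec, cyclicVector,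
    sub_self] at h
  exact (smul_eq_zero.1 h).resolve_left (pow_ne_zero _ (by norm_num))

theorem opAction_invariantsOp_cyclicVector (v : Invariants d N) (n : ZMod N) :
    opAction (frameSection a) (invariantsOp v) (cyclicVector d N) n = Fin.cons 0 (-v n) := by
  have hmon (r : Fin d) : opAction (frameSection a) (monomial (r + 1) 1) (cyclicVector d N) n =
      Pi.single r.succ 1 := by
    rw [← opAction_monomial_cyclicVector a r.succ n, Fin.val_succ, Nat.cast_succ]
  rw [opAction_invariantsOp]
  simp only [hmon]
  ext i
  cases i using Fin.cases <;> simp [Finset.sum_apply, Pi.single_apply]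

theorem DiffOp.eq_sum_monomial {x : DiffOp N} (h₀ : ∀ k < 0, coeff k x = 0)
    (h₁ : ∀ k : ℤ, d < k → coeff k x = 0) :
    x = ∑ j : Fin (d + 1), monomial j (coeff j x) := by
  refine ext_coeff fun k => ?_
  simp only [map_sum, coeff_monomial]
  by_cases hk : 0 ≤ k ∧ k ≤ d
  · obtain ⟨j, rfl⟩ : ∃ j : Fin (d + 1), k = j := ⟨⟨k.toNat, by omega⟩, by simp only; omega⟩
    rw [Finset.sum_eq_single_of_mem j (Finset.mem_univ j) fun s _ hs =>
      if_neg fun h => hs (Fin.ext (by omega)), if_pos rfl]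
  · rw [Finset.sum_eq_zero fun j _ => if_neg (by have := j.2; omega)]
    exact (not_and_or.1 hk).elim (fun h => h₀ k (by omega)) fun h => h₁ k (by omega)

theorem opAction_cyclicVector_apply {x : DiffOp N} (h₀ : ∀ k < 0, coeff k x = 0)
    (h₁ : ∀ k : ℤ, d < k → coeff k x = 0) (n : ZMod N) (i : Fin (d + 1)) :
    opAction (frameSection a) x (cyclicVector d N) n i = coeff i x n := by
  conv_lhs => rw [eq_sum_monomial h₀ h₁]
  rw [map_sum, LinearMap.sum_apply, Finset.sum_apply, Finset.sum_apply]
  simp only [opAction_monomial_apply _ _ (coeff _ x), opAction_monomial_cyclicVector]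
  simp [Pi.single_apply]

end Representation

/-! ### The reduced brackets as Hamiltonian operators -/

section ReducedBrackets

open DiffOp

variable {d N : ℕ}

theorem coeff_upperProjection_gradientPair_snd (m : ℤ) (D Ξ : DiffOp N) {k : ℤ} (hk : 0 < k) :
    coeff k (upperProjection m (gradientPair D Ξ)).2 = coeff k (Ξ * D) := by
  rw [upperProjection_apply, map_add, coeff_posPart, coeff_monomial, if_neg hk.ne', if_pos hk,
    add_zero, gradientPair]

theorem coeff_upperProjection_gradientPair_snd_of_neg (m : ℤ) (D Ξ : DiffOp N) {k : ℤ}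
    (hk : k < 0) : coeff k (upperProjection m (gradientPair D Ξ)).2 = 0 :=
  (upperProjection_mem m (gradientPair D Ξ)).2.1 k hk

theorem coeff_upperProjection_gradientPair_snd_of_gt (e : ℝ) (a : Invariants d N)
    (η : Invariants d N →L[ℝ] ℝ) {k : ℤ} (hk : d < k) :
    coeff k (upperProjection (d + 1) (gradientPair (laxOp e a) (covectorOp η))).2 = 0 := by
  rw [coeff_upperProjection_gradientPair_snd _ _ _ (by omega)]
  exact coeff_mul_of_gt (a := -1) (b := d + 1)
    (fun k hk => coeff_covectorOp_of_nonneg η (by omega)) (fun k hk => coeff_laxOp_of_gt e a hk)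
    (by omega)

/-- The matrices with columns `Tʲ X e₁`, where the operator `X` acts on the constant sequence of
the first basis vector. -/
def krylovMatrix (a : Invariants d N) (X : DiffOp N) (n : ZMod N) :
    Matrix (Fin (d + 1)) (Fin (d + 1)) ℝ :=
  Matrix.of fun i j => opAction (frameSection a) (monomial j 1)
    (opAction (frameSection a) X (cyclicVector d N)) n i

theorem krylovMatrix_apply_zero (a : Invariants d N) (X : DiffOp N) (n : ZMod N)
    (i : Fin (d + 1)) :
    krylovMatrix a X n i 0 = opAction (frameSection a) X (cyclicVector d N) n i := by
  rw [krylovMatrix, Matrix.of_apply, Fin.val_zero, Nat.cast_zero, opAction_monomial_zero_one]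

theorem krylovMatrix_sub (a : Invariants d N) (X : DiffOp N) (n : ZMod N) :
    krylovMatrix a X n
        - (frameSection a n)⁻¹.1 * (krylovMatrix a X (n + 1) * frameMatrix (a n)) =
      Matrix.updateCol 0 0 ((-1 : ℝ) ^ (d + 1) •
        opAction (frameSection a) (laxOp ((-1) ^ (d + 1)) a * X) (cyclicVector d N) n) := by
  set w := opAction (frameSection a) X (cyclicVector d N) with hw
  have hcol (i j) : ((frameSection a n)⁻¹.1 * krylovMatrix a X (n + 1)) i j =
      opAction (frameSection a) (monomial (j + 1) 1) w n i := by
    rw [opAction_monomial_add_one]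
    rfl
  ext i j
  rw [← mul_assoc, Matrix.sub_apply]
  cases j using Fin.cases with
  | zero =>
    have hlax := congrFun (neg_one_pow_smul_opAction_laxOp a (frameSection a) w n) i
    rw [Matrix.updateCol_self, krylovMatrix_apply_zero, map_mul, Module.End.mul_apply, ← hw, hlax,
      Pi.sub_apply, Finset.sum_apply, Matrix.mul_apply]
    simp only [hcol, Pi.smul_apply, smul_eq_mul, mul_comm]
  | succ r =>
    rw [mul_frameMatrix_apply_succ, hcol, Matrix.updateCol_ne (Fin.succ_ne_zero r),
      krylovMatrix, Matrix.of_apply, ← hw, Fin.val_succ, Nat.cast_succ, Fin.val_castSucc, sub_self,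
      Matrix.zero_apply]

theorem trace_mul_eq_sum_of_first_row {M Z : Matrix (Fin (d + 1)) (Fin (d + 1)) ℝ}
    (hM : ∀ i j, ¬(i = 0 ∧ j ≠ 0) → M i j = 0) :
    (M * Z).trace = ∑ r : Fin d, M 0 r.succ * Z r.succ 0 := by
  rw [Matrix.trace, Fin.sum_univ_succ, Finset.sum_eq_zero, add_zero, Matrix.diag_apply,
    Matrix.mul_apply, Fin.sum_univ_succ, hM 0 0 fun h => h.2 rfl, zero_mul, zero_add]
  intro i _
  rw [Matrix.diag_apply, Matrix.mul_apply]
  exact Finset.sum_eq_zero fun j _ => by rw [hM _ _ fun h => Fin.succ_ne_zero i h.1, zero_mul]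

theorem trace_mul_updateCol_zero {ι R : Type*} [Fintype ι] [DecidableEq ι]
    [NonUnitalNonAssocSemiring R] (M : Matrix ι ι R) (j : ι) (z : ι → R) :
    (M * Matrix.updateCol 0 j z).trace = M.mulVec z j := by
  simp [Matrix.mul_updateCol, Matrix.trace, Matrix.updateCol_apply]

variable {a : Invariants d N} {ξ η : Invariants d N →L[ℝ] ℝ}
  {Q P Q' P' : ZMod N → Matrix (Fin (d + 1)) (Fin (d + 1)) ℝ}

theorem IsGradientPair.krylovMatrix_apply_zero (h : IsGradientPair a η Q P) (e : ℝ) (n : ZMod N)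
    (r : Fin d) :
    krylovMatrix a (upperProjection (d + 1) (gradientPair (laxOp e a) (covectorOp η))).2 n
      r.succ 0 = -Q n r.succ 0 := by
  rw [TwistedPolygon.krylovMatrix_apply_zero, opAction_cyclicVector_apply a
    (fun _ => coeff_upperProjection_gradientPair_snd_of_neg _ _ _)
    (fun _ => coeff_upperProjection_gradientPair_snd_of_gt e a η), Fin.val_succ, Nat.cast_succ,
    coeff_upperProjection_gradientPair_snd _ _ _ (by omega), h.coeff_covectorOp_mul_laxOp]

theorem IsGradientPair.trace_mul_inv_frameSection (h : IsGradientPair a ξ Q P) (n : ZMod N)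
    (Z : Matrix (Fin (d + 1)) (Fin (d + 1)) ℝ) :
    (Q n * ((frameSection a n)⁻¹.1 * (Z * frameMatrix (a n)))).trace = (P n * Z).trace := by
  rw [← mul_assoc, ← mul_assoc, Matrix.trace_mul_comm _ (frameMatrix (a n)), ← mul_assoc,
    ← mul_assoc, ← h.mul_eq, mul_assoc (P n), frameMatrix_mul_inv_frameSection, mul_one]

variable [NeZero N]

theorem opAction_laxOp_mul_upperProjection (hcop : Nat.Coprime N (d + 1)) (a : Invariants d N)
    (η : Invariants d N →L[ℝ] ℝ) (n : ZMod N) :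
    opAction (frameSection a) (laxOp ((-1) ^ (d + 1)) a * (upperProjection (d + 1)
      (gradientPair (laxOp ((-1) ^ (d + 1)) a) (covectorOp η))).2) (cyclicVector d N) n =
      Fin.cons 0 (hamiltonian ((-1) ^ (d + 1)) a η n) := by
  have hmul := invariantsOp_hamiltonian hcop ((-1) ^ (d + 1)) a η
  rw [quadField_apply, twoSidedAction, eq_sub_iff_add_eq, ← eq_sub_iff_add_eq'] at hmul
  rw [hmul, map_sub, map_mul, LinearMap.sub_apply, Module.End.mul_apply,
    opAction_laxOp_cyclicVector, map_zero, zero_sub, Pi.neg_apply,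
    opAction_invariantsOp_cyclicVector]
  ext i
  cases i using Fin.cases <;> simp

theorem IsGradientPair.sum_mul_hamiltonian (hcop : Nat.Coprime N (d + 1))
    (h : IsGradientPair a ξ Q P) (η : Invariants d N →L[ℝ] ℝ) {X : DiffOp N}
    (hX : X = (upperProjection (d + 1)
      (gradientPair (laxOp ((-1) ^ (d + 1)) a) (covectorOp η))).2) (n : ZMod N) :
    ∑ r, ξ (Pi.single n (Pi.single r 1)) * hamiltonian ((-1) ^ (d + 1)) a η n r =
      (Q n * krylovMatrix a X n).trace - (P n * krylovMatrix a X (n + 1)).trace := by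
  rw [← h.trace_mul_inv_frameSection, ← Matrix.trace_sub, ← mul_sub, krylovMatrix_sub,
    trace_mul_updateCol_zero, hX, opAction_laxOp_mul_upperProjection hcop, Matrix.mulVec,
    dotProduct, Fin.sum_univ_succ]
  simp only [Pi.smul_apply, smul_eq_mul, Fin.cons_zero, mul_zero, zero_add]
  refine Finset.sum_congr rfl fun r _ => ?_
  rw [h.first_row, Fin.cons_succ]
  linear_combination -ξ (Pi.single n (Pi.single r 1)) * hamiltonian ((-1) ^ (d + 1)) a η n r *
    neg_one_pow_mul_self (d + 1)

theorem IsGradientPair.apply_hamiltonian (hcop : Nat.Coprime N (d + 1))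
    (h : IsGradientPair a ξ Q P) (h' : IsGradientPair a η Q' P') :
    ξ (hamiltonian ((-1) ^ (d + 1)) a η) = ∑ n, (Q' (n + 1) * (P n - Q (n + 1))).trace := by
  rw [covector_apply, Finset.sum_congr rfl fun n _ => h.sum_mul_hamiltonian hcop η rfl n]
  set Z := krylovMatrix a (upperProjection (d + 1)
    (gradientPair (laxOp ((-1) ^ (d + 1)) a) (covectorOp η))).2
  have hZ (n : ZMod N) (r : Fin d) : Z n r.succ 0 = -Q' n r.succ 0 :=
    h'.krylovMatrix_apply_zero _ n r
  have htrace (n : ZMod N) :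
      (Q (n + 1) * Z (n + 1)).trace - (P n * Z (n + 1)).trace =
        (Q' (n + 1) * (P n - Q (n + 1))).trace := by
    have hM (i j) (hij : ¬(i = 0 ∧ j ≠ 0)) : (P n - Q (n + 1)) i j = 0 :=
      sub_eq_zero.2 (h.apply_eq n i j hij)
    rw [← neg_sub (P n * Z (n + 1)).trace, ← Matrix.trace_sub, ← sub_mul,
      Matrix.trace_mul_comm (Q' _),
      trace_mul_eq_sum_of_first_row hM, trace_mul_eq_sum_of_first_row hM,
      ← Finset.sum_neg_distrib]
    exact Finset.sum_congr rfl fun r _ => by rw [hZ, mul_neg, neg_neg]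
  rw [Finset.sum_sub_distrib,
    ← Equiv.sum_comp (Equiv.addRight 1) fun n => (Q n * Z n).trace, ← Finset.sum_sub_distrib]
  exact Finset.sum_congr rfl fun n _ => htrace n

theorem IsGradientPair.sum_first_column_mul_first_row (h : IsGradientPair a ξ Q P)
    (h' : IsGradientPair a η Q' P') :
    ∑ n, ∑ r : Fin d, Q n r.succ 0 * Q' n 0 r.succ =
      (-1) ^ (d + 1) * η (readInvariants (covectorOp ξ * laxOp 0 a)) := by
  rw [covector_apply, Finset.mul_sum]
  refine Finset.sum_congr rfl fun n _ => ?_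
  rw [Finset.mul_sum]
  refine Finset.sum_congr rfl fun r _ => ?_
  rw [readInvariants_apply, h.coeff_covectorOp_mul_laxOp, h'.first_row]
  ring

theorem apply_readInvariants_laxOp_mul_covectorOp (e : ℝ) (a : Invariants d N)
    (ξ η : Invariants d N →L[ℝ] ℝ) :
    ξ (readInvariants (laxOp e a * covectorOp η)) =
      η (readInvariants (covectorOp ξ * laxOp e a)) := by
  rw [← neg_inj, ← trace_covectorOp_mul, ← trace_covectorOp_mul, ← mul_assoc, trace_mul_comm]

theorem IsGradientPair.apply_linearHamiltonian (h : IsGradientPair a ξ Q P)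
    (h' : IsGradientPair a η Q' P') :
    (-1) ^ (d + 1) * ξ (linearHamiltonian a η) =
      ∑ n, (∑ r : Fin d, Q n r.succ 0 * Q' n 0 r.succ
        - ∑ r : Fin d, Q' n r.succ 0 * Q n 0 r.succ) := by
  rw [Finset.sum_sub_distrib, h.sum_first_column_mul_first_row h',
    h'.sum_first_column_mul_first_row h, linearHamiltonian_apply, map_sub, map_sub,
    apply_readInvariants_laxOp_mul_covectorOp, mul_sub]

variable (hcop : Nat.Coprime N (d + 1)) {f g : Invariants d N → ℝ}
  (hf : ContDiff ℝ ∞ f) (hg : ContDiff ℝ ∞ g)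

include hcop hf hg

theorem companionBracket_eq : companionBracket f g =
    ((-1) ^ (d + 1) / 2 : ℝ) • tensorBracket linearHamiltonian f g := by
  ext a
  rw [Pi.smul_apply, tensorBracket, smul_eq_mul, div_mul_eq_mul_div,
    (isGradientPair hcop hf a).apply_linearHamiltonian (isGradientPair hcop hg a)]
  simp only [companionBracket, companionTensor, trace_gradeNegOne_mul_gradeOne]
  ring

theorem reducedBracket_eq :
    reducedBracket f g = tensorBracket (hamiltonian ((-1) ^ (d + 1))) f g := by
  ext a
  have h := isGradientPair hcop hf a
  have h' := isGradientPair hcop hg a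
  have hsum := Finset.sum_congr rfl fun n (_ : n ∈ Finset.univ) =>
    rWedge_add_rWedge_sub_rTensor_add_rTensor (h.apply_eq n) (h'.apply_eq n)
  rw [← Finset.mul_sum, Finset.sum_sub_distrib, ← h.apply_hamiltonian hcop h',
    ← h'.apply_hamiltonian hcop h] at hsum
  rw [reducedBracket, twistedBracket,
    ← Equiv.sum_comp (Equiv.addRight 1) fun n =>
      rWedge (rightGradient (invariantExtension f) (frameSection a) n)
        (rightGradient (invariantExtension g) (frameSection a) n),
    ← Finset.sum_add_distrib, ← Finset.sum_sub_distrib, ← Finset.sum_add_distrib]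
  refine hsum.trans ?_
  have hskew := (isPoissonTensor_hamiltonian hcop ((-1) ^ (d + 1))).skew a
    (fderiv ℝ f a) (fderiv ℝ g a)
  rw [tensorBracket]
  linarith

end ReducedBrackets

end TwistedPolygon

end

theorem mainTheorem1 (d N : ℕ) [NeZero N] (hcop : Nat.Coprime N (d + 1)) :
    (IsOpen (TwistedPolygon.regularSet d N) ∧
      ∀ f : TwistedPolygon.Invariants d N → ℝ, ContDiff ℝ ∞ f →
        TwistedPolygon.IsInvariantExtension f (TwistedPolygon.invariantExtension f)) ∧
    TwistedPolygon.IsPoissonBracket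
      (fun f g : TwistedPolygon.Invariants d N → ℝ =>
        TwistedPolygon.reducedBracket f g + TwistedPolygon.companionBracket f g) ∧
    TwistedPolygon.AreCompatible
      (fun f g : TwistedPolygon.Invariants d N → ℝ => TwistedPolygon.reducedBracket f g)
      (fun f g : TwistedPolygon.Invariants d N → ℝ => TwistedPolygon.companionBracket f g) := by
  have key (s t : ℝ) : TwistedPolygon.IsPoissonBracket
      (fun f g : TwistedPolygon.Invariants d N → ℝ =>
        s • TwistedPolygon.reducedBracket f g + t • TwistedPolygon.companionBracket f g) := by
    refine (TwistedPolygon.isPoissonBracket_pencil hcop s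
      (s * (-1) ^ (d + 1) + t * ((-1) ^ (d + 1) / 2))).congr fun f g hf hg => ?_
    rw [TwistedPolygon.reducedBracket_eq hcop hf hg, TwistedPolygon.companionBracket_eq hcop hf hg,
      TwistedPolygon.hamiltonian_eq_add_smul ((-1) ^ (d + 1)),
      ← one_smul ℝ (TwistedPolygon.hamiltonian 0), TwistedPolygon.tensorBracket_smul_add_smul]
    simp only [one_smul, Pi.add_apply, Pi.smul_apply]
    module
  refine ⟨⟨TwistedPolygon.isOpen_regularSet hcop, fun f hf =>
    TwistedPolygon.isInvariantExtension_invariantExtension hcop hf⟩, ?_, ?_, ?_, key⟩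
  · simpa only [one_smul] using key 1 1
  · simpa only [one_smul, zero_smul, add_zero] using key 1 0
  · simpa only [one_smul, zero_smul, zero_add] using key 0 1
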